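/- Let $\mathcal S$ be a finite set, $\overline{\mathcal S}=\mathcal S\cup\mathcal S^{-1}$, and let $\mathcal R$ be a (possibly infinite) set of cyclically reduced words over $\overline{\mathcal S}$. Let $\overline{\mathcal R}$ be the set of all cyclic shifts of elements of $\mathcal R\cup\mathcal R^{-1}$; its elements are called relators. A piece is a word that is a prefix of two distinct elements of $\overline{\mathcal R}$. Assume that $\mathcal R$ satisfies the $C'(1/6)$ small-cancellation condition: for every $r\in\overline{\mathcal R}$ and every piece $p$ that is a (contiguous) subword of $r$ we have $|p|<|r|/6$. Let $G=\langle\mathcal S\mid\mathcal R\rangle$, let $X=\mathrm{Cay}(G,\mathcal S)$, and let $\gamma$ be a finite or one-sided infinite edge path in $X$ labelled by a reduced (finite or infinite) word $w$ over $\overline{\mathcal S}$. If $$|u|\le \frac{|r|}{3}$$ for every $r\in\overline{\mathcal R}$ and every finite word $u$ that is a (contiguous) subword of both $w$ and $r$, then $\gamma$ is a geodesic in $X$, that is, $d_X(\gamma(i),\gamma(j))=|i-j|$ for any two vertices $\gamma(i),\gamma(j)$ of $\gamma$, where $\gamma(i)$ is the endpoint of the initial subpath of length $i$. -/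

import Mathlib

namespace SmallCancellation

/-- A (finite) word over the symmetrised alphabet: the letter `(s, true)` stands for the generator
`s` and the letter `(s, false)` for its formal inverse. Concatenation is list concatenation and
a subword is a contiguous one (`u <:+: w`). -/
abbrev Word (S : Type*) := List (S × Bool)

/-- The cyclic closure of `R ∪ R⁻¹`: all cyclic shifts of elements of `R` and of their formal
inverses. Its elements are called relators. -/
def symClosure {S : Type*} (R : Set (Word S)) : Set (Word S) :=
  {r | ∃ r₀ ∈ R, r ~r r₀ ∨ r ~r FreeGroup.invRev r₀}

/-- A piece is a common prefix of two distinct relators. -/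
def IsPiece {S : Type*} (R : Set (Word S)) (p : Word S) : Prop :=
  ∃ r ∈ symClosure R, ∃ r' ∈ symClosure R, r ≠ r' ∧ p <+: r ∧ p <+: r'

/-- The small-cancellation condition `C'(lam)`: all elements of `R` are cyclically reduced, and
every piece `p` that is a subword of a relator `r` satisfies `|p| < lam * |r|`. -/
def CPrime {S : Type*} (R : Set (Word S)) (lam : ℝ) : Prop :=
  (∀ r ∈ R, FreeGroup.IsCyclicallyReduced r) ∧
    ∀ r ∈ symClosure R, ∀ p : Word S, IsPiece R p → p <:+: r →
      (p.length : ℝ) < lam * (r.length : ℝ)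

/-- The group `⟨S | R⟩`. -/
abbrev Grp {S : Type*} (R : Set (Word S)) : Type _ :=
  PresentedGroup (FreeGroup.mk '' R)

/-- The element of `⟨S | R⟩` represented by a single letter. -/
def letter {S : Type*} (R : Set (Word S)) (a : S × Bool) : Grp R :=
  PresentedGroup.mk (FreeGroup.mk '' R) (FreeGroup.mk [a])

/-- The Cayley graph of `⟨S | R⟩` with respect to `S`; its graph distance is the metric of the
Cayley graph. (Edge labels, loops and multiple edges, which do not affect the metric, are taken
into account in the notion of a labelled edge path below.) -/
def cay {S : Type*} (R : Set (Word S)) : SimpleGraph (Grp R) :=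
  SimpleGraph.mulCayley (Set.range (PresentedGroup.of : S → Grp R))

/-- `γ 0, …, γ |w|` are the successive vertices of the edge path in the Cayley graph that starts
at `γ 0` and is labelled by `w`: the `i`-th edge goes from `γ i` to `γ i * a`, where `a` is the
`i`-th letter of `w`. -/
def IsPathLabelled {S : Type*} (R : Set (Word S)) (w : Word S) (γ : Fin (w.length + 1) → Grp R) :
    Prop :=
  ∀ i : Fin w.length, γ i.succ = γ i.castSucc * letter R (w.get i)

/-- `γ 0, γ 1, …` are the successive vertices of the infinite edge path in the Cayley graph that
starts at `γ 0` and is labelled by the infinite word `w`. -/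
def IsRayLabelled {S : Type*} (R : Set (Word S)) (w : ℕ → S × Bool) (γ : ℕ → Grp R) : Prop :=
  ∀ i, γ (i + 1) = γ i * letter R (w i)

/-- The finite path with vertices `γ 0, …, γ n` is a geodesic: it is an isometric embedding of
`{0, …, n}` in the Cayley graph. -/
def IsGeodesicPath {S : Type*} (R : Set (Word S)) {n : ℕ} (γ : Fin (n + 1) → Grp R) : Prop :=
  ∀ i j : Fin (n + 1), i ≤ j → (cay R).dist (γ i) (γ j) = (j : ℕ) - (i : ℕ)

/-- The infinite path with vertices `γ 0, γ 1, …` is a geodesic (ray). -/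
def IsGeodesicRay {S : Type*} (R : Set (Word S)) (γ : ℕ → Grp R) : Prop :=
  ∀ i j : ℕ, i ≤ j → (cay R).dist (γ i) (γ j) = j - i

/-- The infinite word `w` is reduced: no two consecutive letters are inverse to each other. -/
def IsReducedInf {S : Type*} (w : ℕ → S × Bool) : Prop :=
  ∀ i, (w i).1 = (w (i + 1)).1 → (w i).2 = (w (i + 1)).2

/-- The finite word `u` is a subword of the infinite word `w`. -/
def IsSubwordInf {S : Type*} (u : Word S) (w : ℕ → S × Bool) : Prop :=
  ∃ n : ℕ, ∀ i : Fin u.length, u.get i = w (n + i)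

end SmallCancellation

/-!
Let `w` be a reduced word containing at most a third of any relator. It suffices that `w` is the
only word of minimal length representing its element of `G` (`eq_of_val_eq`), since the hypothesis
on `w` passes to its subwords, and since the distance in the Cayley graph is the minimal length of a
word (`dist_eq_length`).

Suppose that `g ≠ w` is a shortest word representing the same element. After cancelling common
first and last letters, the word `w g⁻¹` is cyclically reduced, and it is trivial in `G`. By van
Kampen's lemma (`Diagram.exists_of_conjProd`) it bounds a disc diagram over the relators. Choose the
number of faces minimal, and forget the vertices of degree `2` other than the two corners of this
bigon. Every face is then cut into runs. Let `L` be the length of the boundary of a face.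
* A run in the interior is labelled by a piece, hence is shorter than `L / 6`: otherwise the two
  faces next to it are mirror images of each other, and removing both gives a smaller diagram
  (`interior_run`).
* A run on the side `w` has length at most `L / 3`, by hypothesis.
* A run on the side `g` has length at most `L / 2`, since `g` is shortest. Two consecutive runs of
  the same face on this side together still have length at most `L / 2`: they follow one another
  on the side `g`, because a path labelled by a shortest word does not visit a vertex twice
  (`append_infix`).

Counting a run as one if it is interior and as two if it is exterior, it follows that the runs of
every face count for at least six (`six_le_countP`). By Euler's formula the runs of all `n` faces
together count for at most `6 n - 6 + 2 * 2` (`countP_add_six_le`), the last term coming from the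
two corners. This contradiction shows that there is no such bigon (`no_bigon`).

Planarity enters through an inductive definition of disc diagrams (`Diagram`) in terms of words
only. It suffices for what is needed: an edge between two faces, or between a face and the exterior,
can be removed (`Diagram.merge`, `Diagram.open_face`), and Euler's formula holds
(`Diagram.exists_vertices`).
-/

namespace SmallCancellation

/-! ### Disc diagrams -/

section

variable {α : Type*}

/-- Planar disc diagrams, in terms of words only. The letters are oriented edges, or their labels,
and `e` reverses a letter. `Diagram e z f` says that some planar diagram has the boundary word `z`
and the multiset `f` of boundary words of bounded faces. The words are read as on the sphere, with
the exterior as one more face: every edge occurs twice, as a letter `x` and as a letter `e x`, so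
that the boundary of the diagram and those of its faces are read in opposite directions. The point
at which the boundary word of a face starts has no significance.

The constructors add one edge to a diagram. `bridge` joins two diagrams by an edge, both of whose
sides lie on the exterior; `cell` adds an edge outside a diagram, which cuts off a new face together
with a part `t` of the boundary. -/
inductive Diagram (e : α → α) : List α → Multiset (List α) → Prop
  | nil : Diagram e [] 0
  | bridge (x : α) {u v : List α} {f g : Multiset (List α)} :
      Diagram e u f → Diagram e v g → Diagram e (x :: (u ++ e x :: v)) (f + g)
  | cell (x : α) {t v : List α} {f : Multiset (List α)} :
      Diagram e (t ++ v) f → Diagram e (x :: v) ((e x :: t) ::ₘ f)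
  | rot {u v : List α} {f : Multiset (List α)} : Diagram e u f → u ~r v → Diagram e v f

theorem append_eq_append_cons {u v p q : List α} {a : α} (h : u ++ v = p ++ a :: q) :
    (∃ s, u = p ++ a :: s ∧ q = s ++ v) ∨ (∃ s, v = s ++ a :: q ∧ p = u ++ s) := by
  rcases List.append_eq_append_iff.1 h with ⟨s, h1, h2⟩ | ⟨s, h1, h2⟩
  · exact .inr ⟨s, h2, h1⟩
  · cases s with
    | nil => exact .inr ⟨[], by simpa using h2.symm, by simpa using h1.symm⟩
    | cons b s =>
      simp only [List.cons_append, List.cons.injEq] at h2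
      exact .inl ⟨s, by rw [h1, h2.1], h2.2⟩

theorem cons_isRotated_cons {x a : α} {v y : List α} (h : (x :: v) ~r (a :: y)) :
    (x = a ∧ v = y) ∨ ∃ v₁ v₂, v = v₁ ++ a :: v₂ ∧ y = v₂ ++ x :: v₁ := by
  obtain ⟨n, hn, h⟩ := List.isRotated_iff_mod.1 h
  rw [List.rotate_eq_drop_append_take hn] at h
  rcases n with _ | n
  · simp at h; exact .inl h
  · simp only [List.drop_succ_cons, List.take_succ_cons] at h
    have htd : v.take n ++ v.drop n = v := List.take_append_drop n v
    rcases hd : v.drop n with _ | ⟨b, v₂⟩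
    · rw [hd] at h htd
      rw [List.append_nil] at htd
      simp at h
      exact .inl ⟨h.1, by rw [← h.2, htd]⟩
    · rw [hd] at h htd
      simp at h
      exact .inr ⟨v.take n, v₂, by rw [← h.1, htd], h.2.symm⟩

theorem exists_append_of_isRotated {u v : List α} (h : u ~r v) :
    ∃ p q, u = p ++ q ∧ v = q ++ p := by
  obtain ⟨n, hn, h⟩ := List.isRotated_iff_mod.1 h
  rw [List.rotate_eq_drop_append_take hn] at h
  exact ⟨_, _, (List.take_append_drop n _).symm, h.symm⟩

theorem isRotated_swap (u v : List α) {w w' : List α}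
    (hw : w = u ++ v := by simp) (hw' : w' = v ++ u := by simp) : w ~r w' := by
  subst hw hw'
  exact List.isRotated_append

namespace Diagram
variable {e : α → α}

theorem swap (u v : List α) {w w' : List α} {f} (h : Diagram e w f)
    (hw : w = u ++ v := by simp) (hw' : w' = v ++ u := by simp) : Diagram e w' f := by
  subst hw hw'
  exact h.rot List.isRotated_append

/-- The effect of removing the first edge `a` of the boundary: if the other side of `a` is exterior,
the diagram falls apart; otherwise the face on the other side is merged with the exterior. -/
theorem head_cases (he : Function.Involutive e) {z : List α} {f : Multiset (List α)}
    (h : Diagram e z f) : ∀ a y, z ~r (a :: y) →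
    (∃ y₁ y₂ f₁ f₂, y = y₁ ++ e a :: y₂ ∧ f = f₁ + f₂ ∧ Diagram e y₁ f₁ ∧ Diagram e y₂ f₂) ∨
    (∃ t c f', f = c ::ₘ f' ∧ c ~r (e a :: t) ∧ Diagram e (t ++ y) f') := by
  induction h with
  | nil => intro a y h; simp at h
  | rot h hr ih => intro a y h; exact ih a y (hr.trans h)
  | @cell x T V f h ih =>
    intro a y hz
    rcases cons_isRotated_cons hz with ⟨rfl, rfl⟩ | ⟨V1, V2, rfl, rfl⟩
    · exact .inr ⟨T, _, f, rfl, .refl _, h⟩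
    · rcases ih a (V2 ++ T ++ V1) (isRotated_swap (T ++ V1) (a :: V2)) with
        ⟨y1, y2, f1, f2, hy, rfl, h1, h2⟩ | ⟨t, c, f', rfl, hc, h1⟩
      · rw [List.append_assoc] at hy
        rcases append_eq_append_cons hy with ⟨s, rfl, rfl⟩ | ⟨s, hs, rfl⟩
        · refine .inl ⟨y1, s ++ x :: V1, f1, (e x :: T) ::ₘ f2, by simp, by simp, h1, ?_⟩
          exact (Diagram.cell x (t := T) (v := V1 ++ s) (h2.swap s (T ++ V1))).swap (x :: V1) s
        · rcases append_eq_append_cons hs with ⟨q, rfl, rfl⟩ | ⟨q, rfl, rfl⟩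
          · refine .inr ⟨q ++ e x :: s, _, f1 + f2, rfl, isRotated_swap (e x :: s) (e a :: q), ?_⟩
            have h3 := Diagram.bridge (e x) (h1.swap V2 s (w' := s ++ V2))
              (h2.swap q V1 (w' := V1 ++ q))
            rw [he x] at h3
            exact h3.swap (e x :: (s ++ V2 ++ x :: V1)) q
          · refine .inl ⟨V2 ++ x :: q, y2, (e x :: T) ::ₘ f1, f2, by simp, by simp, ?_, h2⟩
            exact (Diagram.cell x (t := T) (v := q ++ V2) (h1.swap V2 (T ++ q))).swap (x :: q) V2
      · refine .inr ⟨t, c, (e x :: T) ::ₘ f', Multiset.cons_swap _ _ _, hc, ?_⟩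
        exact (Diagram.cell x (t := T) (v := V1 ++ t ++ V2)
          (h1.swap (t ++ V2) (T ++ V1))).swap (x :: V1) (t ++ V2)
  | @bridge x U V f g hU hV ihU ihV =>
    intro a y hz
    rcases cons_isRotated_cons hz with ⟨rfl, rfl⟩ | ⟨p, q, hp, rfl⟩
    · exact .inl ⟨U, V, f, g, rfl, rfl, hU, hV⟩
    · rcases append_eq_append_cons hp with ⟨U2, rfl, rfl⟩ | ⟨s, hs, rfl⟩
      · rcases ihU a (U2 ++ p) (isRotated_swap p (a :: U2)) with
          ⟨y1, y2, f1, f2, hy, rfl, h1, h2⟩ | ⟨t, c, f', rfl, hc, h1⟩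
        · rcases append_eq_append_cons hy with ⟨s, rfl, rfl⟩ | ⟨s, rfl, rfl⟩
          · refine .inl ⟨y1, s ++ e x :: V ++ x :: p, f1, f2 + g, by simp, by
              rw [add_assoc], h1, ?_⟩
            exact (Diagram.bridge x (h2.swap s p (w' := p ++ s)) hV).swap
              (x :: p) (s ++ e x :: V)
          · refine .inl ⟨U2 ++ e x :: V ++ x :: s, y2, f1 + g, f2, by simp, by
              rw [add_right_comm], ?_, h2⟩
            exact (Diagram.bridge x (h1.swap U2 s (w' := s ++ U2)) hV).swap
              (x :: s) (U2 ++ e x :: V)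
        · refine .inr ⟨t, c, f' + g, by simp, hc, ?_⟩
          exact (Diagram.bridge x (u := p ++ t ++ U2) (h1.swap (t ++ U2) p) hV).swap
              (x :: p) (t ++ U2 ++ e x :: V)
      · rcases s with _ | ⟨b, s⟩
        · simp only [List.nil_append, List.cons.injEq] at hs
          obtain ⟨rfl, rfl⟩ := hs
          exact .inl ⟨V, U, g, f, by simp [he x], add_comm _ _, hV, hU⟩
        · simp only [List.cons_append, List.cons.injEq] at hs
          obtain ⟨rfl, rfl⟩ := hs
          rcases ihV a (q ++ s) (isRotated_swap s (a :: q)) with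
            ⟨y1, y2, f1, f2, hy, rfl, h1, h2⟩ | ⟨t, c, f', rfl, hc, h1⟩
          · rcases append_eq_append_cons hy with ⟨r, rfl, rfl⟩ | ⟨r, rfl, rfl⟩
            · refine .inl ⟨y1, r ++ x :: U ++ e x :: s, f1, f + f2, by simp, by
                rw [add_left_comm], h1, ?_⟩
              exact (Diagram.bridge x hU (h2.swap r s (w' := s ++ r))).swap
                (x :: U ++ e x :: s) r
            · refine .inl ⟨q ++ x :: U ++ e x :: r, y2, f + f1, f2, by simp, by
                rw [add_assoc], ?_, h2⟩
              exact (Diagram.bridge x hU (h1.swap q r (w' := r ++ q))).swap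
                (x :: U ++ e x :: r) q
          · refine .inr ⟨t, c, f + f', by simp, hc, ?_⟩
            exact (Diagram.bridge x hU (v := s ++ t ++ q) (h1.swap (t ++ q) s)).swap
              (x :: U ++ e x :: s) (t ++ q)

/-- Two diagrams may be glued at a boundary vertex. -/
theorem append_of_isRotated (he : Function.Involutive e) {u : List α} {f : Multiset (List α)}
    (h : Diagram e u f) {v : List α} {g : Multiset (List α)} (hv : Diagram e v g) :
    ∀ y, u ~r y → Diagram e (y ++ v) (f + g) := by
  induction h with
  | nil => intro y hy; rw [List.isRotated_nil_iff'] at hy; subst hy; simpa using hv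
  | rot _ hr ih => intro y hy; exact ih y (hr.trans hy)
  | @cell x T V f h ih =>
    rintro (_ | ⟨a, y⟩) hy
    · simp at hy
    rw [Multiset.cons_add]
    rcases cons_isRotated_cons hy with ⟨rfl, rfl⟩ | ⟨V1, V2, rfl, rfl⟩
    · exact Diagram.cell x (by simpa using ih _ (.refl _))
    · exact (Diagram.cell x (t := T) (v := V1 ++ v ++ a :: V2)
        ((ih (a :: V2 ++ T ++ V1) (isRotated_swap (T ++ V1) (a :: V2))).swap
          (a :: V2) (T ++ V1 ++ v))).swap (x :: V1 ++ v) (a :: V2)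
  | @bridge x U V f f' hU hV ihU ihV =>
    rintro (_ | ⟨a, y⟩) hy
    · simp at hy
    rcases cons_isRotated_cons hy with ⟨rfl, rfl⟩ | ⟨p, q, hp, rfl⟩
    · simpa [add_assoc] using Diagram.bridge x hU (ihV V (.refl _))
    · rcases append_eq_append_cons hp with ⟨U2, rfl, rfl⟩ | ⟨s, hs, rfl⟩
      · have := Diagram.bridge (e x) hV ((ihU (a :: U2 ++ p) (isRotated_swap p (a :: U2))).swap
          (a :: U2) (p ++ v) (w' := p ++ v ++ a :: U2))
        rw [he x, add_left_comm, ← add_assoc] at this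
        exact this.swap (e x :: (V ++ x :: p ++ v)) (a :: U2)
      · rcases s with _ | ⟨b, s⟩
        · simp only [List.nil_append, List.cons.injEq] at hs
          obtain ⟨rfl, rfl⟩ := hs
          have := Diagram.bridge (e x) hV (ihU U (.refl _))
          rw [he x, add_left_comm, ← add_assoc] at this
          simpa using this
        · simp only [List.cons_append, List.cons.injEq] at hs
          obtain ⟨rfl, rfl⟩ := hs
          have := Diagram.bridge x hU ((ihV (a :: q ++ s) (isRotated_swap s (a :: q))).swap
            (a :: q) (s ++ v) (w' := s ++ v ++ a :: q))
          rw [← add_assoc] at this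
          exact this.swap (x :: (U ++ e x :: s ++ v)) (a :: q)

theorem append (he : Function.Involutive e) {u v : List α} {f g : Multiset (List α)}
    (h : Diagram e u f) (hv : Diagram e v g) : Diagram e (u ++ v) (f + g) :=
  h.append_of_isRotated he hv u (.refl _)

/-- If the word `c ++ y` bounds a diagram, then so does `y`, at the cost of (at most) one more face,
with boundary `c`. Faces removed on the way are put back, so that `P` holds for all faces of the new
diagram if it holds for `c` and for those of the given one. -/
theorem fill (he : Function.Involutive e) (P : List α → Prop)
    (hP : ∀ c c', c ~r c' → P c → P c') (c : List α) (hc : P c) (n : ℕ) :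
    ∀ (m : ℕ) (y : List α) (f : Multiset (List α)), y.length ≤ m → f.card ≤ n →
      (∀ x ∈ f, P x) → Diagram e (c ++ y) f →
      ∃ f', Diagram e y f' ∧ f'.card ≤ n + 1 ∧ ∀ x ∈ f', P x := by
  induction n using Nat.strong_induction_on with
  | _ n ihn =>
  intro m
  induction m with
  | zero =>
    intro y f hy _ _ _
    rw [List.length_eq_zero_iff.1 (Nat.le_zero.1 hy)]
    exact ⟨0, .nil, by simp, by simp⟩
  | succ m ihm =>
    intro y f hy hf hPf h
    rcases y with _ | ⟨a, y⟩
    · exact ⟨0, .nil, by simp, by simp⟩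
    simp only [List.length_cons, Nat.add_le_add_iff_right] at hy
    rcases h.head_cases he a (y ++ c) (isRotated_swap c (a :: y)) with
      ⟨y1, y2, f1, f2, hy', rfl, h1, h2⟩ | ⟨t, d, f', rfl, hd, h1⟩
    · -- the edge `a` is a bridge, to an edge of `y` or to one of `c`
      rw [Multiset.card_add] at hf
      rcases append_eq_append_cons hy' with ⟨s, rfl, rfl⟩ | ⟨s, rfl, rfl⟩
      · by_cases h0 : f1.card = 0
        · obtain ⟨g, hg, hgc, hgP⟩ := ihm s f2 (by simp at hy; omega) (by omega)
            (fun x hx => hPf x (Multiset.mem_add.2 (.inr hx))) (h2.swap s c)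
          refine ⟨f1 + g, .bridge a h1 hg, by simp; omega, ?_⟩
          rintro x hx
          rcases Multiset.mem_add.1 hx with hx | hx
          · exact hPf x (Multiset.mem_add.2 (.inl hx))
          · exact hgP x hx
        · obtain ⟨g, hg, hgc, hgP⟩ := ihn f2.card (by omega) _ s f2 le_rfl le_rfl
            (fun x hx => hPf x (Multiset.mem_add.2 (.inr hx))) (h2.swap s c)
          refine ⟨f1 + g, .bridge a h1 hg, by simp; omega, ?_⟩
          rintro x hx
          rcases Multiset.mem_add.1 hx with hx | hx
          · exact hPf x (Multiset.mem_add.2 (.inl hx))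
          · exact hgP x hx
      · refine ⟨(e a :: (y2 ++ s)) ::ₘ (f2 + f1), .cell a ?_, by simp; omega, ?_⟩
        · simpa using append he h2 (h1.swap y s (w' := s ++ y))
        · intro x hx
          rcases Multiset.mem_cons.1 hx with rfl | hx
          · exact hP _ _ (isRotated_swap s (e a :: y2)) hc
          · rw [add_comm] at hx
            exact hPf x hx
    · -- the edge `a` lies on a face: open this face, and close it again in the end
      rw [Multiset.card_cons] at hf
      obtain ⟨g, hg, hgc, hgP⟩ := ihn (n - 1) (by omega) _ (t ++ y) f' le_rfl (by omega)
        (fun x hx => hPf x (Multiset.mem_cons_of_mem hx)) (h1.swap (t ++ y) c)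
      refine ⟨(e a :: t) ::ₘ g, .cell a hg, by simp; omega, ?_⟩
      intro x hx
      rcases Multiset.mem_cons.1 hx with rfl | hx
      · exact hP _ _ hd (hPf d (by simp))
      · exact hgP x hx

/-- The boundary word of a diagram may be freely reduced without increasing the number of faces. -/
theorem cancel (he : Function.Involutive e) (P : List α → Prop)
    (hP : ∀ c c', c ~r c' → P c → P c') {a : α} {y : List α} {f : Multiset (List α)}
    (hPf : ∀ x ∈ f, P x) (h : Diagram e (a :: e a :: y) f) :
    ∃ f', Diagram e y f' ∧ f'.card ≤ f.card ∧ ∀ x ∈ f', P x := by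
  rcases h.head_cases he a (e a :: y) (.refl _) with
      ⟨y1, y2, f1, f2, hy, rfl, h1, h2⟩ | ⟨t, d, f', rfl, hd, h1⟩
  · rcases y1 with _ | ⟨b, y1⟩
    · simp only [List.nil_append, List.cons.injEq, true_and] at hy
      subst hy
      exact ⟨f2, h2, by simp, fun x hx => hPf x (Multiset.mem_add.2 (.inr hx))⟩
    · simp only [List.cons_append, List.cons.injEq] at hy
      obtain ⟨rfl, rfl⟩ := hy
      refine ⟨f1 + f2, ?_, le_rfl, hPf⟩
      simpa using append he (h1.swap [e a] y1 (w' := y1 ++ [e a])) h2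
  · obtain ⟨g, hg, hgc, hgP⟩ := fill he P hP (t ++ [e a])
      (hP d _ (hd.trans (isRotated_swap [e a] t)) (hPf d (by simp))) f'.card _ y f' le_rfl le_rfl
        (fun x hx => hPf x (Multiset.mem_cons_of_mem hx)) (by simpa using h1)
    exact ⟨g, hg, by simpa using hgc, hgP⟩

end Diagram

end

/-! ### Van Kampen's lemma -/

section

variable {S : Type*}

/-- The formal inverse of a letter. -/
def bar (a : S × Bool) : S × Bool := (a.1, !a.2)

theorem bar_involutive : Function.Involutive (bar (S := S)) := fun a => by simp [bar]

theorem invRev_cons (a : S × Bool) (s : Word S) :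
    FreeGroup.invRev (a :: s) = FreeGroup.invRev s ++ [bar a] := by
  simp [FreeGroup.invRev, bar]

theorem invRev_append (s t : Word S) :
    FreeGroup.invRev (s ++ t) = FreeGroup.invRev t ++ FreeGroup.invRev s := by
  simp [FreeGroup.invRev]

theorem mk_cons (a : S × Bool) (s : Word S) :
    FreeGroup.mk (a :: s) = FreeGroup.mk [a] * FreeGroup.mk s := by
  rw [FreeGroup.mul_mk]; rfl

theorem mk_bar (a : S × Bool) : FreeGroup.mk [bar a] = (FreeGroup.mk [a])⁻¹ := by
  rw [FreeGroup.inv_mk, invRev_cons]; rfl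

theorem isRotated_invRev {c c' : Word S} (h : c ~r c') :
    FreeGroup.invRev c ~r FreeGroup.invRev c' := (h.map _).reverse

section
variable {R : Set (Word S)}

theorem symClosure_of_isRotated {c c' : Word S} (h : c ~r c') (hc : c ∈ symClosure R) :
    c' ∈ symClosure R := by
  obtain ⟨r, hr, h1 | h1⟩ := hc
  · exact ⟨r, hr, .inl (h.symm.trans h1)⟩
  · exact ⟨r, hr, .inr (h.symm.trans h1)⟩

theorem invRev_mem_symClosure {c : Word S} (hc : c ∈ symClosure R) :
    FreeGroup.invRev c ∈ symClosure R := by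
  obtain ⟨r, hr, h1 | h1⟩ := hc
  · exact ⟨r, hr, .inr (isRotated_invRev h1)⟩
  · exact ⟨r, hr, .inl (by simpa [FreeGroup.invRev_invRev] using isRotated_invRev h1)⟩

/-- `ConjProd R n x`: the element `x` of the free group is a product of `n` conjugates of relators,
so that the area of `x` is the least such `n`. -/
inductive ConjProd (R : Set (Word S)) : ℕ → FreeGroup S → Prop
  | one : ConjProd R 0 1
  | cons {n : ℕ} {x : FreeGroup S} (c : Word S) (u : FreeGroup S) :
      c ∈ symClosure R → ConjProd R n x → ConjProd R (n + 1) (u * FreeGroup.mk c * u⁻¹ * x)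

namespace ConjProd

theorem mul {m n : ℕ} {x y : FreeGroup S} (hx : ConjProd R m x) (hy : ConjProd R n y) :
    ConjProd R (m + n) (x * y) := by
  induction hx with
  | one => simpa using hy
  | cons c u hc _ ih =>
    rw [mul_assoc, Nat.add_right_comm]
    exact .cons c u hc ih

theorem conj {n : ℕ} {x : FreeGroup S} (hx : ConjProd R n x) (g : FreeGroup S) :
    ConjProd R n (g * x * g⁻¹) := by
  induction hx with
  | one => simpa using ConjProd.one
  | @cons n x c u hc _ ih =>
    have := ConjProd.cons c (g * u) hc ih
    rwa [show g * u * FreeGroup.mk c * (g * u)⁻¹ * (g * x * g⁻¹)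
      = g * (u * FreeGroup.mk c * u⁻¹ * x) * g⁻¹ by group] at this

/-- An element of the free group that is trivial in `⟨S | R⟩` has finite area. -/
theorem exists_of_mk_eq_one {x : FreeGroup S}
    (h : PresentedGroup.mk (FreeGroup.mk '' R) x = 1) : ∃ n, ConjProd R n x := by
  have hx : x ∈ Subgroup.normalClosure (FreeGroup.mk '' R) := (QuotientGroup.eq_one_iff x).1 h
  rw [Subgroup.normalClosure] at hx
  clear h
  have key : ∀ y ∈ Group.conjugatesOfSet (FreeGroup.mk '' R),
      (∃ n, ConjProd R n y) ∧ ∃ n, ConjProd R n y⁻¹ := by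
    intro y hy
    obtain ⟨a, ⟨r, hr, rfl⟩, hy⟩ := Group.mem_conjugatesOfSet_iff.1 hy
    obtain ⟨g, rfl⟩ := isConj_iff.1 hy
    have hr' : r ∈ symClosure R := ⟨r, hr, .inl (.refl _)⟩
    refine ⟨⟨1, by simpa using ConjProd.cons r g hr' .one⟩, ⟨1, ?_⟩⟩
    have := ConjProd.cons _ g (invRev_mem_symClosure hr') .one
    rw [← FreeGroup.inv_mk] at this
    simpa [mul_assoc] using this
  induction hx using Subgroup.closure_induction'' with
  | mem y hy => exact (key y hy).1
  | inv_mem y hy => exact (key y hy).2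
  | one => exact ⟨0, .one⟩
  | mul x y _ _ hx hy =>
    obtain ⟨m, hm⟩ := hx
    obtain ⟨n, hn⟩ := hy
    exact ⟨m + n, hm.mul hn⟩

end ConjProd

namespace Diagram

/-- The word `s s⁻¹` bounds a tree, namely a path. -/
theorem append_invRev (s : Word S) : Diagram bar (s ++ FreeGroup.invRev s) 0 := by
  induction s with
  | nil => exact .nil
  | cons a s ih =>
    rw [invRev_cons]
    simpa using Diagram.bridge a ih .nil

theorem conj {z : Word S} {f : Multiset (Word S)} (h : Diagram bar z f) (s : Word S) :
    Diagram bar (s ++ z ++ FreeGroup.invRev s) f := by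
  induction s with
  | nil => simpa [FreeGroup.invRev] using h
  | cons a s ih =>
    rw [invRev_cons]
    simpa using Diagram.bridge a ih .nil

/-- A relator bounds a single face. (The empty word, which may be a relator, bounds a point.) -/
theorem exists_of_relator {c : Word S} (hc : c ∈ symClosure R) :
    ∃ f, Diagram bar c f ∧ f.card ≤ 1 ∧ ∀ x ∈ f, x ∈ symClosure R := by
  rcases c with _ | ⟨a, s⟩
  · exact ⟨0, .nil, by simp, by simp⟩
  · refine ⟨_, .cell (t := FreeGroup.invRev s) a ((append_invRev s).swap s _ rfl rfl), by simp, ?_⟩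
    simp only [Multiset.cons_zero, Multiset.mem_singleton, forall_eq]
    refine symClosure_of_isRotated ?_ (invRev_mem_symClosure hc)
    rw [invRev_cons]
    exact isRotated_swap (FreeGroup.invRev s) [bar a]

theorem exists_of_red {z z' : Word S} (h : FreeGroup.Red z z') {f : Multiset (Word S)}
    (hd : Diagram bar z f) (hf : ∀ x ∈ f, x ∈ symClosure R) :
    ∃ f', Diagram bar z' f' ∧ f'.card ≤ f.card ∧ ∀ x ∈ f', x ∈ symClosure R := by
  induction h with
  | refl => exact ⟨f, hd, le_rfl, hf⟩
  | tail _ hs ih =>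
    obtain ⟨g, hg, hgc, hgP⟩ := ih
    obtain @⟨p, q, x, b⟩ := hs
    obtain ⟨k, hk, hkc, hkP⟩ := cancel bar_involutive (· ∈ symClosure R)
      (fun _ _ => symClosure_of_isRotated) hgP (a := (x, b)) (y := q ++ p)
      (hg.swap p ((x, b) :: (x, !b) :: q) (by simp) (by simp [bar]))
    exact ⟨k, hk.swap q p, hkc.trans hgc, hkP⟩

/-- **Van Kampen's lemma.** A reduced word representing a product of `n` conjugates of relators is
the boundary of a diagram with at most `n` faces, all bounded by relators. -/
theorem exists_of_conjProd {n : ℕ} {w : Word S} (hw : FreeGroup.IsReduced w)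
    (h : ConjProd R n (FreeGroup.mk w)) :
    ∃ f, Diagram bar w f ∧ f.card ≤ n ∧ ∀ x ∈ f, x ∈ symClosure R := by
  classical
  have key : ∀ {n x}, ConjProd R n x → ∃ z f, FreeGroup.mk z = x ∧ Diagram bar z f ∧
      f.card ≤ n ∧ ∀ x ∈ f, x ∈ symClosure R := by
    intro n x hx
    induction hx with
    | one => exact ⟨[], 0, rfl, .nil, by simp, by simp⟩
    | cons c u hc _ ih =>
      obtain ⟨z, f, rfl, hz, hf, hP⟩ := ih
      obtain ⟨g, hg, hgc, hgP⟩ := exists_of_relator hc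
      refine ⟨u.toWord ++ c ++ FreeGroup.invRev u.toWord ++ z, g + f, ?_,
        append bar_involutive (hg.conj _) hz, by simp; omega, ?_⟩
      · rw [← FreeGroup.mul_mk, ← FreeGroup.mul_mk, ← FreeGroup.mul_mk, ← FreeGroup.inv_mk,
          FreeGroup.mk_toWord]
      · intro x hx
        rcases Multiset.mem_add.1 hx with hx | hx
        · exact hgP x hx
        · exact hP x hx
  obtain ⟨z, f, hz, hd, hf, hP⟩ := key h
  have hred : FreeGroup.Red z w := by
    rw [← hw.reduce_eq, ← FreeGroup.reduce.sound hz]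
    exact FreeGroup.reduce.red
  obtain ⟨g, hg, hgc, hgP⟩ := exists_of_red hred hd hP
  exact ⟨g, hg, hgc.trans hf, hgP⟩

open Classical in
/-- The boundary word of a diagram is a product of conjugates of relators, one for each face whose
boundary word is not trivial in the free group. -/
theorem conjProd {z : Word S} {f : Multiset (Word S)} (h : Diagram bar z f)
    (hf : ∀ c ∈ f, FreeGroup.mk c = 1 ∨ c ∈ symClosure R) :
    ConjProd R (f.countP fun c => FreeGroup.mk c ≠ 1) (FreeGroup.mk z) := by
  induction h with
  | nil => exact .one
  | @rot u v f _ hr ih =>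
    obtain ⟨p, q, hu, hv⟩ := exists_append_of_isRotated hr
    have := (ih hf).conj (FreeGroup.mk p)⁻¹
    rw [hu, ← FreeGroup.mul_mk] at this
    rw [hv, ← FreeGroup.mul_mk]
    convert this using 1
    group
  | @bridge x u v f g _ _ ihu ihv =>
    rw [Multiset.countP_add]
    have h1 := (ihu fun c hc => hf c (Multiset.mem_add.2 (.inl hc))).conj (FreeGroup.mk [x])
    have := h1.mul (ihv fun c hc => hf c (Multiset.mem_add.2 (.inr hc)))
    rwa [← mk_bar, FreeGroup.mul_mk, FreeGroup.mul_mk, FreeGroup.mul_mk,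
      show [x] ++ u ++ [bar x] ++ v = x :: (u ++ bar x :: v) by simp] at this
  | @cell x t v f _ ih =>
    have h1 := ih fun c hc => hf c (Multiset.mem_cons_of_mem hc)
    have e1 : FreeGroup.mk (bar x :: t) = (FreeGroup.mk [x])⁻¹ * FreeGroup.mk t := by
      rw [mk_cons, mk_bar]
    by_cases hc : FreeGroup.mk (bar x :: t) = 1
    · rw [Multiset.countP_cons, if_neg (by simpa using hc), add_zero]
      rw [e1, inv_mul_eq_one] at hc
      rwa [mk_cons, hc, FreeGroup.mul_mk]
    · -- the face is read in the opposite direction, whence the inverse of its boundary word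
      rw [Multiset.countP_cons, if_pos hc]
      have h2 := ConjProd.cons _ (FreeGroup.mk [x])
        (invRev_mem_symClosure ((hf _ (Multiset.mem_cons_self _ _)).resolve_left hc)) h1
      rw [← FreeGroup.inv_mk, e1, ← FreeGroup.mul_mk] at h2
      rw [mk_cons]
      convert h2 using 1
      group

end Diagram
end

end

/-! ### Darts, and the removal of edges -/

section

variable {α : Type*}

/-- The multiset of all darts (oriented edges) of a diagram: the letters of its boundary word and of
its faces. It has no duplicates if the letters are really edges and not just their labels. -/
def darts (z : List α) (f : Multiset (List α)) : Multiset α :=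
  z + (f.map Multiset.ofList).sum

theorem darts_cons (z c : List α) (f : Multiset (List α)) :
    darts z (c ::ₘ f) = c + darts z f := by
  simp [darts, add_left_comm]

theorem mem_darts {z : List α} {f : Multiset (List α)} {d : α} :
    d ∈ darts z f ↔ d ∈ z ∨ ∃ c ∈ f, d ∈ c := by
  induction f using Multiset.induction_on with
  | empty => simp [darts]
  | cons c f ih =>
    rw [darts_cons, Multiset.mem_add, ih]
    simp only [Multiset.mem_coe, Multiset.mem_cons, exists_eq_or_imp]
    tauto

theorem darts_bridge (e : α → α) (x : α) (u v : List α) (f g : Multiset (List α)) :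
    darts (x :: (u ++ e x :: v)) (f + g) = x ::ₘ e x ::ₘ (darts u f + darts v g) := by
  simp only [darts, Multiset.map_add, Multiset.sum_add, ← Multiset.cons_coe,
    ← Multiset.coe_add, Multiset.cons_add, Multiset.add_cons]
  congr 2
  abel

theorem darts_cell (e : α → α) (x : α) (t v : List α) (f : Multiset (List α)) :
    darts (x :: v) ((e x :: t) ::ₘ f) = x ::ₘ e x ::ₘ darts (t ++ v) f := by
  simp only [darts, Multiset.map_cons, Multiset.sum_cons, ← Multiset.cons_coe,
    ← Multiset.coe_add, Multiset.cons_add, Multiset.add_cons]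
  rw [Multiset.cons_swap]
  congr 2
  abel

theorem darts_rot {u v : List α} (h : u ~r v) (f : Multiset (List α)) : darts v f = darts u f := by
  rw [darts, darts, Multiset.coe_eq_coe.2 h.perm]

theorem eq_of_cons_isRotated_cons {a : α} {l l' : List α} (h : (a :: l) ~r (a :: l'))
    (hn : (a :: l).Nodup) : l = l' := by
  rcases cons_isRotated_cons h with ⟨_, h⟩ | ⟨p, q, rfl, _⟩
  · exact h
  · simp at hn

theorem exists_isRotated_cons {a : α} {l : List α} (h : a ∈ l) : ∃ t, l ~r (a :: t) := by
  obtain ⟨p, q, rfl⟩ := List.append_of_mem h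
  exact ⟨q ++ p, isRotated_swap p (a :: q)⟩

section Nodup
variable {z : List α} {f : Multiset (List α)}

theorem nodup_boundary (h : (darts z f).Nodup) : z.Nodup :=
  Multiset.coe_nodup.1 (Multiset.nodup_add.1 h).1

theorem nodup_face (h : (darts z f).Nodup) {c : List α} (hc : c ∈ f) : c.Nodup := by
  obtain ⟨g, rfl⟩ := Multiset.exists_cons_of_mem hc
  rw [darts_cons] at h
  exact Multiset.coe_nodup.1 (Multiset.nodup_add.1 h).1

theorem not_mem_boundary (h : (darts z f).Nodup) {c : List α} (hc : c ∈ f) {d : α} (hd : d ∈ c) :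
    d ∉ z := by
  obtain ⟨g, rfl⟩ := Multiset.exists_cons_of_mem hc
  rw [darts_cons] at h
  intro hz
  exact Multiset.disjoint_left.1 (Multiset.nodup_add.1 h).2.2 hd (mem_darts.2 (.inl hz))

theorem not_mem_of_cons {c : List α} (h : (darts z (c ::ₘ f)).Nodup) {d : α} (hd : d ∈ c)
    {c' : List α} (hc' : c' ∈ f) : d ∉ c' := by
  rw [darts_cons] at h
  intro hz
  exact Multiset.disjoint_left.1 (Multiset.nodup_add.1 h).2.2 hd (mem_darts.2 (.inr ⟨_, hc', hz⟩))

end Nodup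

namespace Diagram
variable {e : α → α}

/-- The darts of a diagram are closed under reversal. -/
theorem bar_mem_darts (he : Function.Involutive e) {z : List α} {f : Multiset (List α)}
    (h : Diagram e z f) : ∀ d ∈ darts z f, e d ∈ darts z f := by
  induction h with
  | nil => simp [darts]
  | rot _ hr ih => rw [darts_rot hr]; exact ih
  | bridge x _ _ ih1 ih2 =>
    rw [darts_bridge]
    intro d hd
    simp only [Multiset.mem_cons, Multiset.mem_add] at hd ⊢
    rcases hd with rfl | rfl | hd | hd
    · tauto
    · rw [he]; tauto
    · have := ih1 d hd; tauto
    · have := ih2 d hd; tauto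
  | cell x _ ih =>
    rw [darts_cell]
    intro d hd
    simp only [Multiset.mem_cons] at hd ⊢
    rcases hd with rfl | rfl | hd
    · tauto
    · rw [he]; tauto
    · have := ih d hd; tauto

/-- Removing an edge `d` between the boundary and a face merges the face with the exterior. -/
theorem open_face (he : Function.Involutive e) {z c y t : List α} {f : Multiset (List α)} {d : α}
    (h : Diagram e z (c ::ₘ f)) (hn : (darts z (c ::ₘ f)).Nodup) (hz : z ~r (d :: y))
    (hc : c ~r (e d :: t)) : Diagram e (t ++ y) f := by
  have hdc : e d ∈ c := hc.mem_iff.2 (by simp)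
  rcases h.head_cases he d y hz with ⟨y₁, y₂, f₁, f₂, hy, -⟩ | ⟨t', c', f', hf, hc', h'⟩
  · exact absurd (hz.mem_iff.2 (by simp [hy])) (not_mem_boundary hn (by simp) hdc)
  · have hdc' : e d ∈ c' := hc'.mem_iff.2 (by simp)
    rcases Multiset.cons_eq_cons.1 hf with ⟨rfl, rfl⟩ | ⟨_, g, rfl, rfl⟩
    · have := hc.symm.trans hc'
      rwa [eq_of_cons_isRotated_cons this (hc.nodup_iff.1 (nodup_face hn (by simp)))]
    · exact absurd hdc' (not_mem_of_cons hn hdc (by simp))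

/-- The case of `Diagram.merge` in which one of the faces is cut off by the last edge `x` of the
construction. -/
theorem merge_cell (he : Function.Involutive e) {t v c s s' : List α} {f : Multiset (List α)}
    {x d : α} (h : Diagram e (t ++ v) (c ::ₘ f))
    (hn : (darts (x :: v) ((e x :: t) ::ₘ c ::ₘ f)).Nodup)
    (hs : (e x :: t) ~r (d :: s)) (hs' : c ~r (e d :: s')) :
    ∃ m, m ~r (s ++ s') ∧ Diagram e (x :: v) (m ::ₘ f) := by
  have hdc : e d ∈ c := hs'.mem_iff.2 (by simp)
  rcases cons_isRotated_cons hs with ⟨rfl, rfl⟩ | ⟨t₁, t₂, rfl, rfl⟩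
  · rw [he] at hdc
    exact absurd (by simp) (not_mem_boundary hn (c := c) (by simp) hdc)
  · rw [darts_cell] at hn
    have h1 := open_face he h (Multiset.nodup_cons.1 (Multiset.nodup_cons.1 hn).2).2
      (y := t₂ ++ v ++ t₁) (isRotated_swap t₁ (d :: t₂ ++ v)) hs'
    exact ⟨e x :: (t₁ ++ s' ++ t₂), isRotated_swap (e x :: t₁ ++ s') t₂,
      .cell x (h1.swap (s' ++ t₂ ++ v) t₁)⟩

/-- Removing an edge `d` between two distinct faces merges these faces. -/
theorem merge (he : Function.Involutive e) {z : List α} {F : Multiset (List α)}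
    (h : Diagram e z F) : ∀ {c c' s s' : List α} {f : Multiset (List α)} {d : α},
      F = c ::ₘ c' ::ₘ f → (darts z F).Nodup → c ~r (d :: s) → c' ~r (e d :: s') →
      ∃ m, m ~r (s ++ s') ∧ Diagram e z (m ::ₘ f) := by
  induction h with
  | nil => intro c c' s s' f d hf; simp at hf
  | rot _ hr ih =>
    intro c c' s s' f d hf hn hs hs'
    rw [darts_rot hr] at hn
    obtain ⟨m, hm, h⟩ := ih hf hn hs hs'
    exact ⟨m, hm, h.rot hr⟩
  | @cell x t v F h ih =>
    intro c c' s s' f d hf hn hs hs'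
    rcases Multiset.cons_eq_cons.1 hf with ⟨rfl, rfl⟩ | ⟨_, g, rfl, hg⟩
    · exact merge_cell he h hn hs hs'
    · rcases Multiset.cons_eq_cons.1 hg with ⟨rfl, rfl⟩ | ⟨_, g', rfl, rfl⟩
      · obtain ⟨m, hm, h⟩ := merge_cell he h hn hs' (by rwa [he])
        exact ⟨m, hm.trans List.isRotated_append, h⟩
      · rw [darts_cell] at hn
        obtain ⟨m, hm, h⟩ := ih rfl (Multiset.nodup_cons.1 (Multiset.nodup_cons.1 hn).2).2 hs hs'
        exact ⟨m, hm, by rw [Multiset.cons_swap]; exact h.cell x⟩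
  | @bridge x u v F G hu hv ihu ihv =>
    intro c c' s s' f d hf hn hs hs'
    rw [darts_bridge] at hn
    obtain ⟨hnu, hnv, hdis⟩ := Multiset.nodup_add.1
      (Multiset.nodup_cons.1 (Multiset.nodup_cons.1 hn).2).2
    have hdc : d ∈ c := hs.mem_iff.2 (by simp)
    have hdc' : e d ∈ c' := hs'.mem_iff.2 (by simp)
    have hc : c ∈ F + G := by rw [hf]; simp
    rcases Multiset.mem_add.1 hc with hc | hc
    · obtain ⟨F, rfl⟩ := Multiset.exists_cons_of_mem hc
      rw [Multiset.cons_add, Multiset.cons_inj_right] at hf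
      have hc' : c' ∈ F + G := by rw [hf]; simp
      rcases Multiset.mem_add.1 hc' with hc' | hc'
      · obtain ⟨F, rfl⟩ := Multiset.exists_cons_of_mem hc'
        rw [Multiset.cons_add, Multiset.cons_inj_right] at hf
        obtain ⟨m, hm, h⟩ := ihu rfl hnu hs hs'
        exact ⟨m, hm, by rw [← hf, ← Multiset.cons_add]; exact .bridge x h hv⟩
      · exact absurd (mem_darts.2 (.inr ⟨_, hc', hdc'⟩)) (Multiset.disjoint_left.1 hdis
          (hu.bar_mem_darts he _ (mem_darts.2 (.inr ⟨_, hc, hdc⟩))))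
    · obtain ⟨G, rfl⟩ := Multiset.exists_cons_of_mem hc
      rw [Multiset.add_cons, Multiset.cons_inj_right] at hf
      have hc' : c' ∈ F + G := by rw [hf]; simp
      rcases Multiset.mem_add.1 hc' with hc' | hc'
      · exact absurd (hv.bar_mem_darts he _ (mem_darts.2 (.inr ⟨_, hc, hdc⟩)))
          (Multiset.disjoint_left.1 hdis (mem_darts.2 (.inr ⟨_, hc', hdc'⟩)))
      · obtain ⟨G, rfl⟩ := Multiset.exists_cons_of_mem hc'
        rw [Multiset.add_cons, Multiset.cons_inj_right] at hf
        obtain ⟨m, hm, h⟩ := ihv rfl hnv hs hs'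
        exact ⟨m, hm, by rw [← hf, ← Multiset.add_cons]; exact .bridge x hu h⟩

theorem map {β : Type*} {e' : β → β} (φ : α → β) (hφ : ∀ a, φ (e a) = e' (φ a)) {z : List α}
    {f : Multiset (List α)} (h : Diagram e z f) :
    Diagram e' (z.map φ) (f.map (List.map φ)) := by
  induction h with
  | nil => exact .nil
  | rot _ hr ih => exact ih.rot (hr.map φ)
  | bridge x _ _ ih1 ih2 =>
    simpa [hφ] using Diagram.bridge (φ x) ih1 ih2
  | cell x _ ih =>
    rw [List.map_append] at ih
    simpa [hφ] using Diagram.cell (φ x) ih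

/-- The boundary words of a diagram lift to words in pairwise distinct oriented edges, an edge being
a letter together with a number that identifies it. The numbers are taken from an interval `[N, M)`,
so that the lifts of two diagrams can be made disjoint. -/
theorem exists_lift {z : List α} {f : Multiset (List α)} (he : ∀ a, e a ≠ a)
    (h : Diagram e z f) :
    ∀ N : ℕ, ∃ (M : ℕ) (Z : List (ℕ × α)) (F : Multiset (List (ℕ × α))),
      Diagram (Prod.map id e) Z F ∧ Z.map Prod.snd = z ∧ F.map (List.map Prod.snd) = f ∧
      (darts Z F).Nodup ∧ N ≤ M ∧ ∀ d ∈ darts Z F, N ≤ d.1 ∧ d.1 < M := by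
  induction h with
  | nil => exact fun N => ⟨N, [], 0, .nil, rfl, rfl, by simp [darts], le_rfl, by simp [darts]⟩
  | rot _ hr ih =>
    intro N
    obtain ⟨M, Z, F, h, rfl, rfl, hn, hM, hb⟩ := ih N
    obtain ⟨n, rfl⟩ := hr
    refine ⟨M, Z.rotate n, F, h.rot ⟨n, rfl⟩, List.map_rotate .., rfl, ?_, hM, ?_⟩ <;>
      rwa [darts_rot ⟨n, rfl⟩]
  | bridge x _ _ ih1 ih2 =>
    intro N
    obtain ⟨M, Z, F, h, rfl, rfl, hn, hM, hb⟩ := ih1 N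
    obtain ⟨M', Z', F', h', rfl, rfl, hn', hM', hb'⟩ := ih2 M
    refine ⟨M' + 1, (M', x) :: (Z ++ (M', e x) :: Z'), F + F', .bridge (M', x) h h',
      by simp, by simp, ?_, by omega, ?_⟩
    · rw [show (M', e x) = Prod.map id e (M', x) from rfl, darts_bridge]
      have h0 : ∀ y, (M', y) ∉ darts Z F + darts Z' F' := by
        intro y hy
        rcases Multiset.mem_add.1 hy with hy | hy
        · have := (hb _ hy).2; simp only at this; omega
        · exact absurd (hb' _ hy).2 (lt_irrefl _)
      refine Multiset.nodup_cons.2 ⟨?_, Multiset.nodup_cons.2 ⟨h0 _, Multiset.nodup_add.2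
        ⟨hn, hn', Multiset.disjoint_left.2 fun {a} ha ha' => ?_⟩⟩⟩
      · simp only [Multiset.mem_cons, not_or, Prod.map_apply, id_eq, Prod.mk.injEq, true_and]
        exact ⟨(he x).symm, h0 _⟩
      · have := (hb _ ha).2; have := (hb' _ ha').1; omega
    · rw [show (M', e x) = Prod.map id e (M', x) from rfl, darts_bridge]
      intro d hd
      simp only [Multiset.mem_cons, Multiset.mem_add] at hd
      rcases hd with rfl | rfl | hd | hd
      · simp only; omega
      · simp only [Prod.map_apply, id_eq]; omega
      · have := hb _ hd; omega
      · have := hb' _ hd; omega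
  | @cell x t v _ _ ih =>
    intro N
    obtain ⟨M, Z, F, h, hZ, rfl, hn, hM, hb⟩ := ih N
    obtain ⟨T, V, rfl, rfl, rfl⟩ := List.map_eq_append_iff.1 hZ
    have h0 : ∀ y, (M, y) ∉ darts (T ++ V) F := fun y hy => absurd (hb _ hy).2 (lt_irrefl _)
    refine ⟨M + 1, (M, x) :: V, ((M, e x) :: T) ::ₘ F, .cell (M, x) h, by simp, by simp, ?_,
      by omega, ?_⟩
    · rw [show (M, e x) = Prod.map id e (M, x) from rfl, darts_cell]
      refine Multiset.nodup_cons.2 ⟨?_, Multiset.nodup_cons.2 ⟨h0 _, hn⟩⟩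
      simp only [Multiset.mem_cons, not_or, Prod.map_apply, id_eq, Prod.mk.injEq, true_and]
      exact ⟨(he x).symm, h0 _⟩
    · rw [show (M, e x) = Prod.map id e (M, x) from rfl, darts_cell]
      intro d hd
      simp only [Multiset.mem_cons] at hd
      rcases hd with rfl | rfl | hd
      · simp only; omega
      · simp only [Prod.map_apply, id_eq]; omega
      · have := hb _ hd; omega

end Diagram

end

/-! ### Vertices and Euler's formula -/

section

variable {α V : Type*}

/-- `z` is an edge path from `b` to `c`, where `ν d` is the initial vertex of the dart `d` and
`ν (e d)` is its terminal vertex. -/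
def Walk (e : α → α) (ν : α → V) : V → List α → V → Prop
  | b, [], c => b = c
  | b, d :: z, c => ν d = b ∧ Walk e ν (ν (e d)) z c

namespace Walk
variable {e : α → α} {ν : α → V}

theorem append_iff {u v : List α} {b c : V} :
    Walk e ν b (u ++ v) c ↔ ∃ m, Walk e ν b u m ∧ Walk e ν m v c := by
  induction u generalizing b with
  | nil => simp [Walk]
  | cons d u ih => simp [Walk, ih, and_assoc]

theorem congr {V' : Type*} {ν' : α → V'} {z : List α} (i : V → V')
    (h : ∀ d ∈ z, ν' d = i (ν d) ∧ ν' (e d) = i (ν (e d))) {b c : V} (hw : Walk e ν b z c) :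
    Walk e ν' (i b) z (i c) := by
  induction z generalizing b with
  | nil => exact congrArg i hw
  | cons d z ih =>
    obtain ⟨rfl, hw⟩ := hw
    have hd := h d (by simp)
    refine ⟨hd.1, ?_⟩
    rw [hd.2]
    exact ih (fun d hd => h d (by simp [hd])) hw

theorem prod_eq {G : Type*} [Group G] {lab : α → G} {γ : V → G} {z : List α}
    (h : ∀ d ∈ z, γ (ν (e d)) = γ (ν d) * lab d) {b c : V} (hw : Walk e ν b z c) :
    γ c = γ b * (z.map lab).prod := by
  induction z generalizing b with
  | nil => simp [show b = c from hw]
  | cons d z ih =>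
    obtain ⟨rfl, hw⟩ := hw
    rw [ih (fun d hd => h d (by simp [hd])) hw, h d (by simp), List.map_cons, List.prod_cons,
      mul_assoc]

/-- The boundary path of a face may be started at any of its vertices. -/
theorem rot {u v : List α} {b : V} (hw : Walk e ν b u b) (hr : u ~r v) :
    ∃ c, Walk e ν c v c := by
  obtain ⟨p, q, hu, hv⟩ := exists_append_of_isRotated hr
  subst hu hv
  obtain ⟨m, h1, h2⟩ := append_iff.1 hw
  exact ⟨m, append_iff.2 ⟨b, h2, h1⟩⟩

end Walk

open Classical in
/-- The vertices of a diagram: `ν d` is the initial vertex of the dart `d`, and `b` is the base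
point of the boundary. The last clause is Euler's formula for a disc, `|V| - |E| + |F| = 1`, doubled
since every edge is made of two darts. The map `γ` from vertices to `G` is compatible with the
labels `lab` of edges; it exists since the labels of the faces are trivial in `G`. -/
theorem Diagram.exists_vertices {e : α → α} (he : Function.Involutive e) {G : Type*} [Group G]
    {lab : α → G} (hlab : ∀ a, lab (e a) = (lab a)⁻¹) {z : List α} {f : Multiset (List α)}
    (h : Diagram e z f) (hn : (darts z f).Nodup) (hf : ∀ c ∈ f, (c.map lab).prod = 1) :
    ∃ (V : Type) (_ : Fintype V) (ν : α → V) (γ : V → G) (b : V),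
      Walk e ν b z b ∧ (∀ c ∈ f, ∃ b, Walk e ν b c b) ∧
      (∀ v, v = b ∨ ∃ d ∈ darts z f, ν d = v) ∧
      (∀ d ∈ darts z f, γ (ν (e d)) = γ (ν d) * lab d) ∧
      2 * Fintype.card V + 2 * f.card = (darts z f).card + 2 := by
  induction h with
  | nil =>
    exact ⟨Unit, inferInstance, fun _ => (), fun _ => 1, (), rfl, by simp, by simp,
      by simp [darts], by simp [darts]⟩
  | @rot u v f _ hr ih =>
    rw [darts_rot hr] at hn ⊢
    obtain ⟨V, _, ν, γ, b, hw, hfw, hv, hγ, hc⟩ := ih hn hf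
    rcases u with _ | ⟨d, u⟩
    · rw [List.isRotated_nil_iff'] at hr
      subst hr
      exact ⟨V, inferInstance, ν, γ, b, hw, hfw, hv, hγ, hc⟩
    · obtain ⟨c, hc'⟩ := hw.rot hr
      refine ⟨V, inferInstance, ν, γ, c, hc', hfw, fun v => .inr ?_, hγ, hc⟩
      rcases hv v with rfl | hv
      · exact ⟨d, mem_darts.2 (by simp), hw.1⟩
      · exact hv
  | @cell x t v f h ih =>
    rw [darts_cell] at hn ⊢
    obtain ⟨hx, hn'⟩ := Multiset.nodup_cons.1 hn
    obtain ⟨hex, hn'⟩ := Multiset.nodup_cons.1 hn'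
    have hxe : x ≠ e x := fun h => hx (by rw [← h]; simp)
    have hx' : x ∉ darts (t ++ v) f := fun h => hx (by simp [h])
    obtain ⟨V, _, ν, γ, b, hw, hfw, hv, hγ, hc⟩ :=
      ih hn' fun c hc => hf c (Multiset.mem_cons_of_mem hc)
    obtain ⟨m, hw1, hw2⟩ := Walk.append_iff.1 hw
    -- the new edge joins two vertices of the given diagram
    let ν' : α → V := fun d => if d = x then b else if d = e x then m else ν d
    have hν' : ∀ d ∈ darts (t ++ v) f, ν' d = ν d := fun d hd => by
      have h1 : d ≠ x := fun h => hx' (h ▸ hd)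
      have h2 : d ≠ e x := fun h => hex (h ▸ hd)
      simp [ν', h1, h2]
    have hν2 : ∀ d ∈ darts (t ++ v) f, ν' d = ν d ∧ ν' (e d) = ν (e d) := fun d hd =>
      ⟨hν' d hd, hν' _ (h.bar_mem_darts he d hd)⟩
    have hνx : ν' x = b := by simp [ν']
    have hνe : ν' (e x) = m := by simp [ν', hxe.symm]
    refine ⟨V, inferInstance, ν', γ, b, ⟨hνx, ?_⟩, ?_, ?_, ?_, ?_⟩
    · rw [hνe]
      exact hw2.congr id fun d hd => hν2 d (mem_darts.2 (by simp [hd]))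
    · intro c hc
      rcases Multiset.mem_cons.1 hc with rfl | hc
      · refine ⟨m, hνe, ?_⟩
        rw [he, hνx]
        exact hw1.congr id fun d hd => hν2 d (mem_darts.2 (by simp [hd]))
      · obtain ⟨b', hb'⟩ := hfw c hc
        exact ⟨b', hb'.congr id fun d hd => hν2 d (mem_darts.2 (.inr ⟨c, hc, hd⟩))⟩
    · intro w
      rcases hv w with rfl | ⟨d, hd, rfl⟩
      · exact .inl rfl
      · exact .inr ⟨d, by simp [hd], hν' d hd⟩
    · have key : γ m = γ b * lab x := by
        rw [hw1.prod_eq (lab := lab) fun d hd => hγ d (mem_darts.2 (by simp [hd]))]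
        have := hf _ (Multiset.mem_cons_self _ _)
        rw [List.map_cons, List.prod_cons, hlab, inv_mul_eq_one] at this
        rw [this]
      intro d hd
      simp only [Multiset.mem_cons] at hd
      rcases hd with rfl | rfl | hd
      · rw [hνx, hνe, key]
      · rw [he, hνx, hνe, key, hlab]
        group
      · rw [(hν2 d hd).1, (hν2 d hd).2, hγ d hd]
    · simp only [Multiset.card_cons]
      omega
  | @bridge x u v f g hu hv ihu ihv =>
    rw [darts_bridge] at hn ⊢
    obtain ⟨hx, hn'⟩ := Multiset.nodup_cons.1 hn
    obtain ⟨hex, hn'⟩ := Multiset.nodup_cons.1 hn'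
    have hxe : x ≠ e x := fun h => hx (by rw [← h]; simp)
    have hx' : x ∉ darts u f + darts v g := fun h => hx (by simp [h])
    simp only [Multiset.mem_add, not_or] at hx' hex
    obtain ⟨hnu, hnv, hdis⟩ := Multiset.nodup_add.1 hn'
    obtain ⟨V, _, ν, γ, b, hw, hfw, hV, hγ, hc⟩ :=
      ihu hnu fun c hc => hf c (Multiset.mem_add.2 (.inl hc))
    obtain ⟨V', _, ν', γ', b', hw', hfw', hV', hγ', hc'⟩ :=
      ihv hnv fun c hc => hf c (Multiset.mem_add.2 (.inr hc))
    -- the vertices are those of the two parts; `γ` is translated on the first part to fit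
    let μ : α → V ⊕ V' := fun d => if d ∈ darts u f then .inl (ν d) else
      if d = x then .inr b' else if d = e x then .inl b else .inr (ν' d)
    have hμ : ∀ d ∈ darts u f, μ d = .inl (ν d) := fun d hd => by simp [μ, hd]
    have hμ' : ∀ d ∈ darts v g, μ d = .inr (ν' d) := fun d hd => by
      have h0 : d ∉ darts u f := Multiset.disjoint_right.1 hdis hd
      have h1 : d ≠ x := fun h => hx'.2 (h ▸ hd)
      have h2 : d ≠ e x := fun h => hex.2 (h ▸ hd)
      simp [μ, h0, h1, h2]
    have hμ2 : ∀ d ∈ darts u f, μ d = .inl (ν d) ∧ μ (e d) = .inl (ν (e d)) := fun d hd =>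
      ⟨hμ d hd, hμ _ (hu.bar_mem_darts he d hd)⟩
    have hμ2' : ∀ d ∈ darts v g, μ d = .inr (ν' d) ∧ μ (e d) = .inr (ν' (e d)) := fun d hd =>
      ⟨hμ' d hd, hμ' _ (hv.bar_mem_darts he d hd)⟩
    have hμx : μ x = .inr b' := by simp [μ, hx'.1]
    have hμe : μ (e x) = .inl b := by simp [μ, hex.1, hxe.symm]
    refine ⟨V ⊕ V', inferInstance, μ,
      Sum.elim (fun w => γ' b' * lab x * (γ b)⁻¹ * γ w) γ', .inr b', ⟨hμx, ?_⟩, ?_, ?_, ?_, ?_⟩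
    · rw [hμe]
      refine Walk.append_iff.2 ⟨.inl b, hw.congr Sum.inl fun d hd => hμ2 d (mem_darts.2 (.inl hd)),
        hμe, ?_⟩
      rw [he, hμx]
      exact hw'.congr Sum.inr fun d hd => hμ2' d (mem_darts.2 (.inl hd))
    · intro c hc
      rcases Multiset.mem_add.1 hc with hc | hc
      · obtain ⟨a, ha⟩ := hfw c hc
        exact ⟨_, ha.congr Sum.inl fun d hd => hμ2 d (mem_darts.2 (.inr ⟨c, hc, hd⟩))⟩
      · obtain ⟨a, ha⟩ := hfw' c hc
        exact ⟨_, ha.congr Sum.inr fun d hd => hμ2' d (mem_darts.2 (.inr ⟨c, hc, hd⟩))⟩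
    · rintro (w | w)
      · refine .inr ?_
        rcases hV w with rfl | ⟨d, hd, rfl⟩
        · exact ⟨e x, by simp, hμe⟩
        · exact ⟨d, by simp [hd], hμ d hd⟩
      · rcases hV' w with rfl | ⟨d, hd, rfl⟩
        · exact .inl rfl
        · exact .inr ⟨d, by simp [hd], hμ' d hd⟩
    · intro d hd
      simp only [Multiset.mem_cons, Multiset.mem_add] at hd
      rcases hd with rfl | rfl | hd | hd
      · simp [hμx, hμe]
      · rw [he, hμx, hμe, hlab]
        simp
      · simp [hμ2 d hd, hγ d hd, mul_assoc]
      · simp [hμ2' d hd, hγ' d hd]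
    · simp only [Multiset.card_cons, Multiset.card_add, Fintype.card_sum]
      omega

end

/-! ### Curvature and runs along faces -/

section

variable {α V : Type*}

theorem Walk.eq_of_isRotated {e : α → α} {ν : α → V} {f l : List α} {b : V} {d d' : α}
    (hw : Walk e ν b f b) (hr : f ~r (d :: d' :: l)) : ν (e d) = ν d' := by
  obtain ⟨c, hc⟩ := hw.rot hr
  exact hc.2.1.symm

theorem sum_mul_countP [Fintype V] [DecidableEq V] (ν : α → V) (p : V → ℕ) (s : Multiset α) :
    ∑ v, p v * s.countP (fun d => ν d = v) = (s.map fun d => p (ν d)).sum := by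
  induction s using Multiset.induction_on with
  | empty => simp
  | cons a s ih => simp [Multiset.countP_cons, mul_add, Finset.sum_add_distrib, ih, add_comm]

theorem sum_map_ite_eq_countP (p : α → Prop) [DecidablePred p] (s : Multiset α) :
    (s.map fun d => if p d then 1 else 0).sum = s.countP p := by
  induction s using Multiset.induction_on with
  | empty => simp
  | cons a s ih => simp [Multiset.countP_cons, ih, add_comm]

open Classical in
/-- **Gauss-Bonnet.** In a planar map with `n` bounded faces in which every vertex has degree at
least `2`, count the darts whose initial vertex is of degree at least `3` or belongs to `J`. The
multiset `s` consists of all darts, `hE` is Euler's formula, and the degree of a vertex is the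
number of darts that start at it. -/
theorem countP_add_six_le [Fintype V] (ν : α → V) (s : Multiset α) (J : Finset V) (n : ℕ)
    (hE : 2 * Fintype.card V + 2 * n = s.card + 2)
    (hdeg : ∀ v, 2 ≤ s.countP (fun d => ν d = v)) :
    s.countP (fun d => ν d ∈ J ∨ 3 ≤ s.countP (fun d' => ν d' = ν d)) + 6 ≤ 6 * n + 2 * J.card := by
  have h1 := sum_mul_countP ν (fun _ => 1) s
  simp only [one_mul] at h1
  have h2 := sum_mul_countP ν
    (fun v => if v ∈ J ∨ 3 ≤ s.countP (fun d' => ν d' = v) then 1 else 0) s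
  have h3 : ∑ v, (if v ∈ J then 1 else 0) = J.card := by simp
  have h4 : ∑ v : V, (6 + (if v ∈ J ∨ 3 ≤ s.countP (fun d' => ν d' = v) then 1 else 0)
      * s.countP (fun d => ν d = v)) ≤
      ∑ v, (3 * s.countP (fun d => ν d = v) + 2 * (if v ∈ J then 1 else 0)) := by
    -- `6 + deg v ≤ 3 * deg v` if `3 ≤ deg v`; for `v ∈ J` the extra `2` allows `deg v = 2`
    refine Finset.sum_le_sum fun v _ => ?_
    have := hdeg v
    by_cases hJ : v ∈ J <;> by_cases h : 3 ≤ s.countP (fun d' => ν d' = v) <;>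
      simp [hJ, h] <;> omega
  rw [Finset.sum_add_distrib, Finset.sum_add_distrib, ← Finset.mul_sum, ← Finset.mul_sum, h1, h2,
    h3] at h4
  rw [sum_map_ite_eq_countP] at h4
  simp at h4
  omega

theorem three_le_countP {s : Multiset α} {p : α → Prop} [DecidablePred p] {a b c : α}
    (ha : a ∈ s) (hb : b ∈ s) (hc : c ∈ s) (hab : a ≠ b) (hac : a ≠ c) (hbc : b ≠ c)
    (pa : p a) (pb : p b) (pc : p c) : 3 ≤ s.countP p := by
  rw [Multiset.countP_eq_card_filter]
  have : ({a, b, c} : Multiset α) ≤ s.filter p := by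
    rw [Multiset.le_iff_subset (by simp [hab, hac, hbc])]
    intro x hx
    simp only [Multiset.insert_eq_cons, Multiset.mem_cons, Multiset.mem_singleton] at hx
    rw [Multiset.mem_filter]
    rcases hx with rfl | rfl | rfl <;> simp [*]
  simpa using Multiset.card_le_card this

theorem eq_of_mem_of_mem {z : List α} {F : Multiset (List α)} (hn : (darts z F).Nodup)
    {f f' : List α} (hf : f ∈ z ::ₘ F) (hf' : f' ∈ z ::ₘ F) {d : α} (hd : d ∈ f) (hd' : d ∈ f') :
    f = f' := by
  rcases Multiset.mem_cons.1 hf with rfl | h <;> rcases Multiset.mem_cons.1 hf' with rfl | h'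
  · rfl
  · exact absurd hd (not_mem_boundary hn h' hd')
  · exact absurd hd' (not_mem_boundary hn h hd)
  · by_contra hne
    obtain ⟨g, rfl⟩ := Multiset.exists_cons_of_mem h
    exact not_mem_of_cons hn hd ((Multiset.mem_cons.1 h').resolve_left (Ne.symm hne)) hd'

theorem exists_mem_of_mem_darts {z : List α} {F : Multiset (List α)} {d : α}
    (hd : d ∈ darts z F) : ∃ f ∈ z ::ₘ F, d ∈ f := by
  rcases mem_darts.1 hd with h | ⟨c, hc, h⟩
  · exact ⟨z, by simp, h⟩
  · exact ⟨c, by simp [hc], h⟩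

theorem mem_darts_of_mem {z : List α} {F : Multiset (List α)} {d : α} {f : List α}
    (hf : f ∈ z ::ₘ F) (hd : d ∈ f) : d ∈ darts z F := by
  rcases Multiset.mem_cons.1 hf with rfl | h
  · exact mem_darts.2 (.inl hd)
  · exact mem_darts.2 (.inr ⟨f, h, hd⟩)

theorem nodup_of_mem {z : List α} {F : Multiset (List α)} (hn : (darts z F).Nodup)
    {f : List α} (hf : f ∈ z ::ₘ F) : f.Nodup := by
  rcases Multiset.mem_cons.1 hf with rfl | h
  · exact nodup_boundary hn
  · exact nodup_face hn h

section Net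
variable {e : α → α} (he : Function.Involutive e) (hne : ∀ a, e a ≠ a) {z : List α}
  {F : Multiset (List α)} (hn : (darts z F).Nodup) (hcl : ∀ d ∈ darts z F, e d ∈ darts z F)
  {ν : α → V} (hw : ∀ f ∈ z ::ₘ F, ∃ b, Walk e ν b f b)
  (hred : ∀ f ∈ z ::ₘ F, ∀ d l, ¬ f ~r (d :: e d :: l))

open Classical

include hne hcl hw hred

/-- No vertex has degree `1`, as no face, the exterior included, runs along an edge and immediately
back. -/
theorem two_le_degree {d : α} (hd : d ∈ darts z F) :
    2 ≤ (darts z F).countP (fun d' => ν d' = ν d) := by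
  obtain ⟨f, hf, hdf⟩ := exists_mem_of_mem_darts hd
  obtain ⟨t, ht⟩ := exists_isRotated_cons hdf
  obtain ⟨b, hb⟩ := hw f hf
  have key : ∃ p ∈ darts z F, p ≠ d ∧ ν p = ν d := by
    rcases List.eq_nil_or_concat t with rfl | ⟨t, p, rfl⟩
    · obtain ⟨c, hc⟩ := hb.rot ht
      exact ⟨e d, hcl d hd, hne d, hc.2.trans hc.1.symm⟩
    · rw [List.concat_eq_append] at ht
      have hr : f ~r (p :: d :: t) := ht.trans (isRotated_swap (d :: t) [p])
      refine ⟨e p, hcl p (mem_darts_of_mem hf (hr.mem_iff.2 (by simp))), ?_,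
        hb.eq_of_isRotated hr⟩
      rintro rfl
      exact hred f hf _ _ hr
  obtain ⟨p, hp, hpd, hν⟩ := key
  rw [Multiset.countP_eq_card_filter]
  have : ({p, d} : Multiset α) ≤ (darts z F).filter (fun d' => ν d' = ν d) := by
    rw [Multiset.le_iff_subset (by simp [hpd])]
    intro x hx
    simp only [Multiset.insert_eq_cons, Multiset.mem_cons, Multiset.mem_singleton] at hx
    rw [Multiset.mem_filter]
    rcases hx with rfl | rfl <;> simp [*]
  simpa using Multiset.card_le_card this

include he hn

/-- At a vertex of degree `2`, a path `c c'` along a face is also run through, in the opposite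
direction, by a face on the other side. -/
theorem exists_turn {f l : List α} (hf : f ∈ z ::ₘ F) {c c' : α} (hr : f ~r (c :: c' :: l))
    (hdeg : ¬ 3 ≤ (darts z F).countP (fun d => ν d = ν (e c))) :
    ∃ f' ∈ z ::ₘ F, ∃ l', f' ~r (e c' :: e c :: l') := by
  obtain ⟨b, hb⟩ := hw f hf
  have hν := hb.eq_of_isRotated hr
  have hc : c ∈ darts z F := mem_darts_of_mem hf (hr.mem_iff.2 (by simp))
  have hc' : c' ∈ darts z F := mem_darts_of_mem hf (hr.mem_iff.2 (by simp))
  have hcc : c ≠ c' := by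
    have := hr.nodup_iff.1 (nodup_of_mem hn hf)
    simp at this
    exact this.1.1
  have hce : c' ≠ e c := by
    rintro rfl
    exact hred f hf _ _ hr
  obtain ⟨f', hf', hcf'⟩ := exists_mem_of_mem_darts (hcl c hc)
  obtain ⟨t, ht⟩ := exists_isRotated_cons hcf'
  obtain ⟨b', hb'⟩ := hw f' hf'
  rcases List.eq_nil_or_concat t with rfl | ⟨t, p, rfl⟩
  · obtain ⟨b'', h1, h2⟩ := hb'.rot ht
    rw [he] at h2
    exact absurd (three_le_countP (p := fun d => ν d = ν (e c)) hc hc' (hcl c hc) hcc (hne c).symm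
      hce (h2.trans h1.symm) hν.symm rfl) hdeg
  · rw [List.concat_eq_append] at ht
    have hr' : f' ~r (p :: e c :: t) := ht.trans (isRotated_swap (e c :: t) [p])
    have hp : p ∈ darts z F := mem_darts_of_mem hf' (hr'.mem_iff.2 (by simp))
    have hpc : e p ≠ e c := by
      intro h
      rw [he.injective h] at hr'
      exact hred f' hf' _ _ hr'
    by_cases hpc' : e p = c'
    · rw [← he p, hpc'] at hr'
      exact ⟨f', hf', t, hr'⟩
    · exact absurd (three_le_countP (p := fun d => ν d = ν (e c)) (hcl p hp) hc' (hcl c hc) hpc'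
        hpc hce (hb'.eq_of_isRotated hr') hν.symm rfl) hdeg

/-- A path along a face whose interior vertices have degree `2` has a single face on its other side,
which may be the exterior or the same face again. -/
theorem exists_mirror {f : List α} (hf : f ∈ z ::ₘ F) (s : List α) (d : α) :
    ∀ rest, f ~r (s ++ d :: rest) →
    (∀ x ∈ s, ¬ 3 ≤ (darts z F).countP (fun y => ν y = ν (e x))) →
    ∃ f' ∈ z ::ₘ F, ∃ m, f' ~r (m ++ ((s ++ [d]).map e).reverse) := by
  induction s with
  | nil =>
    intro rest hr _
    have hd : d ∈ darts z F := mem_darts_of_mem hf (hr.mem_iff.2 (by simp))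
    obtain ⟨f', hf', h⟩ := exists_mem_of_mem_darts (hcl d hd)
    obtain ⟨t, ht⟩ := exists_isRotated_cons h
    exact ⟨f', hf', t, ht.trans (isRotated_swap [e d] t)⟩
  | cons c s ih =>
    intro rest hr hs
    obtain ⟨f', hf', m, hm⟩ := ih (rest ++ [c])
      (hr.trans (isRotated_swap [c] (s ++ d :: rest))) fun x hx => hs x (by simp [hx])
    have hnf := hr.nodup_iff.1 (nodup_of_mem hn hf)
    obtain ⟨c', s', hs'⟩ : ∃ c' s', s ++ [d] = c' :: s' := by
      rcases s with _ | ⟨c', s⟩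
      · exact ⟨d, [], rfl⟩
      · exact ⟨c', s ++ [d], rfl⟩
    have hr' : f ~r (c :: c' :: (s' ++ rest)) := by
      have : c :: s ++ d :: rest = c :: ((s ++ [d]) ++ rest) := by simp
      rwa [this, hs'] at hr
    obtain ⟨f'', hf'', l', hl'⟩ := exists_turn he hne hn hcl hw hred hf hr' (hs c (by simp))
    rw [hs', List.map_cons, List.reverse_cons] at hm
    obtain rfl : f' = f'' := eq_of_mem_of_mem hn hf' hf'' (d := e c')
      (hm.mem_iff.2 (by simp)) (hl'.mem_iff.2 (by simp))
    have h1 : (e c' :: (m ++ (s'.map e).reverse)) ~r (e c' :: e c :: l') :=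
      (isRotated_swap (m ++ (s'.map e).reverse) [e c']).symm.trans
        ((by simpa using hm.symm : (m ++ (s'.map e).reverse ++ [e c']) ~r f').trans hl')
    have h2 := eq_of_cons_isRotated_cons h1
      ((by simpa using hm.trans (isRotated_swap (m ++ (s'.map e).reverse) [e c']) :
        f' ~r (e c' :: (m ++ (s'.map e).reverse))).nodup_iff.1 (nodup_of_mem hn hf'))
    rcases m with _ | ⟨a, m⟩
    · -- otherwise the path closes up, and `c` occurs twice along it
      exfalso
      have : e c ∈ (s'.map e).reverse := by
        rw [List.nil_append] at h2
        rw [h2]; simp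
      simp only [List.mem_reverse, List.mem_map] at this
      obtain ⟨x, hx, hxc⟩ := this
      rw [he.injective hxc] at hx
      have := hr'.nodup_iff.1 (nodup_of_mem hn hf)
      simp [hx] at this
    · simp only [List.cons_append, List.cons.injEq] at h2
      obtain ⟨rfl, rfl⟩ := h2
      refine ⟨f', hf', m, ?_⟩
      rw [List.cons_append, hs']
      simpa using hm.trans (isRotated_swap [e c] (m ++ ((s'.map e).reverse ++ [e c'])))

end Net

/-- A list is cut into runs that end at the elements satisfying `E`; bounds for the lengths of the
runs add up to a bound for the length of the list. The list `s` is the part of the current run that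
has been read already. -/
theorem length_le_sum_runs (E : α → Prop) [DecidablePred E] (g : α → ℕ) (k : ℕ) (l : List α) :
    ∀ s : List α, (∀ x ∈ s, ¬ E x) →
      (∀ s' d, (s' ++ [d]) <:+: (s ++ l) → (∀ x ∈ s', ¬ E x) → E d →
        k * (s'.length + 1) ≤ g d) →
      (l = [] → s = []) → (∀ d ∈ l.getLast?, E d) →
      k * (s.length + l.length) ≤ ((l.filter E).map g).sum := by
  induction l with
  | nil => intro s _ _ h _; simp [h rfl]
  | cons d l ih =>
    intro s hs hrun _ hlast
    have hl : ∀ x ∈ l.getLast?, E x := by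
      rcases l with _ | ⟨b, l⟩
      · simp
      · simpa using hlast
    by_cases hd : E d
    · have h1 := hrun s d ⟨[], l, by simp⟩ hs hd
      have h2 := ih [] (by simp) (fun s' d' h => hrun s' d' (h.trans ⟨s ++ [d], [], by simp⟩))
        (fun _ => rfl) hl
      simp only [List.filter_cons, hd, decide_true, if_true, List.map_cons, List.sum_cons,
        List.length_cons, List.length_nil, zero_add] at h2 ⊢
      nlinarith
    · have h2 := ih (s ++ [d]) (by simpa [or_imp, forall_and, hd] using hs)
        (by simpa using hrun) (by
          rintro rfl
          exact absurd (hlast d (by simp)) hd) hl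
      simp only [List.filter_cons, hd, decide_false] at h2 ⊢
      simpa [add_assoc, add_comm, add_left_comm] using h2

end

/-! ### Cyclically reduced words and shortest words -/

section

variable {S : Type*}

/-- A word none of whose cyclic shifts can be freely reduced. -/
def CycRed (w : Word S) : Prop := ∀ a l, ¬ w ~r (a :: bar a :: l)

namespace CycRed

theorem of_isRotated {w w' : Word S} (h : CycRed w) (hr : w ~r w') : CycRed w' :=
  fun a l h' => h a l (hr.trans h')

theorem isReduced {w : Word S} (h : CycRed w) : FreeGroup.IsReduced w := by
  refine FreeGroup.IsReduced.of_forall_not_step fun w' hs => ?_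
  obtain @⟨p, q, x, b⟩ := hs
  exact h (x, b) (q ++ p) (isRotated_swap p ((x, b) :: (x, !b) :: q) rfl rfl)

theorem of_isCyclicallyReduced {w : Word S} (h : FreeGroup.IsCyclicallyReduced w) : CycRed w := by
  rintro a l hr
  obtain ⟨p, q, hw, hl⟩ := exists_append_of_isRotated hr
  subst hw
  have hab : ¬ (a.1 = (bar a).1 → a.2 = (bar a).2) := by simp [bar]
  rcases q with _ | ⟨b, q⟩
  · simp only [List.nil_append] at hl
    subst hl
    have := h.1
    rw [List.append_nil, FreeGroup.isReduced_cons_cons] at this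
    exact hab this.1
  · simp only [List.cons_append, List.cons.injEq] at hl
    obtain ⟨rfl, hl⟩ := hl
    rcases q with _ | ⟨b, q⟩
    · simp only [List.nil_append] at hl
      subst hl
      exact hab (h.2 a (by rw [List.getLast?_append]; simp) (bar a) (by simp))
    · simp only [List.cons_append, List.cons.injEq] at hl
      obtain ⟨rfl, hl⟩ := hl
      have : FreeGroup.IsReduced [a, bar a] := h.1.infix ⟨p, q, by simp⟩
      rw [FreeGroup.isReduced_cons_cons] at this
      exact hab this.1

theorem invRev {w : Word S} (h : CycRed w) : CycRed (FreeGroup.invRev w) := by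
  intro a l hr
  have := isRotated_invRev hr
  rw [FreeGroup.invRev_invRev, invRev_cons, invRev_cons, bar_involutive] at this
  exact h a _ (this.trans (isRotated_swap (FreeGroup.invRev l) [a, bar a] (by simp) rfl))

end CycRed

/-- A free group has no elements of order two. -/
theorem eq_nil_of_invRev_eq {s : Word S} (h : FreeGroup.IsReduced s)
    (hs : FreeGroup.invRev s = s) : s = [] := by
  induction s using List.bidirectionalRec with
  | nil => rfl
  | singleton a => simp [FreeGroup.invRev, Prod.ext_iff] at hs
  | cons_append a l b ih =>
    rw [invRev_cons, invRev_append] at hs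
    have h1 : FreeGroup.invRev [b] = [bar b] := rfl
    rw [h1, List.append_assoc, List.singleton_append, List.cons.injEq] at hs
    obtain ⟨rfl, hs⟩ := hs
    have h2 := List.append_inj hs (by simp)
    have h3 := ih (h.infix ⟨[bar b], [b], by simp⟩) h2.1
    subst h3
    simp [FreeGroup.IsReduced, bar] at h

/-- A nonempty cyclically reduced word is not a cyclic shift of its inverse: otherwise it is a
product of two words that are equal to their inverses. -/
theorem CycRed.not_isRotated_invRev {w : Word S} (h : CycRed w) (h0 : w ≠ []) :
    ¬ w ~r FreeGroup.invRev w := by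
  intro hr
  obtain ⟨p, q, hw, hl⟩ := exists_append_of_isRotated hr
  subst hw
  rw [invRev_append] at hl
  obtain ⟨h1, h2⟩ := List.append_inj hl (by simp)
  have hp := eq_nil_of_invRev_eq (h.isReduced.infix ⟨[], q, by simp⟩) h2
  have hq := eq_nil_of_invRev_eq (h.isReduced.infix ⟨p, [], by simp⟩) h1
  simp [hp, hq] at h0

section
variable {R : Set (Word S)}

/-- The element of `⟨S | R⟩` represented by a word. -/
def val (R : Set (Word S)) (w : Word S) : Grp R :=
  PresentedGroup.mk (FreeGroup.mk '' R) (FreeGroup.mk w)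

theorem val_nil : val R [] = 1 := map_one _

theorem val_append (u v : Word S) : val R (u ++ v) = val R u * val R v := by
  rw [val, ← FreeGroup.mul_mk, map_mul]; rfl

theorem val_invRev (u : Word S) : val R (FreeGroup.invRev u) = (val R u)⁻¹ := by
  rw [val, ← FreeGroup.inv_mk, map_inv]; rfl

theorem val_singleton (a : S × Bool) : val R [a] = letter R a := rfl

theorem prod_letter (w : Word S) : (w.map (letter R)).prod = val R w := by
  induction w with
  | nil => exact val_nil.symm
  | cons a w ih =>
    rw [List.map_cons, List.prod_cons, ih, ← val_singleton, ← val_append]; rfl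

theorem letter_bar (a : S × Bool) : letter R (bar a) = (letter R a)⁻¹ := by
  rw [← val_singleton, ← val_singleton, ← val_invRev]; rfl

theorem mk_eq_one_of_isRotated {c c' : Word S} (hr : c ~r c') (h : FreeGroup.mk c = 1) :
    FreeGroup.mk c' = 1 := by
  obtain ⟨p, q, hc, hc'⟩ := exists_append_of_isRotated hr
  rw [hc, ← FreeGroup.mul_mk, mul_eq_one_iff_eq_inv'] at h
  rw [hc', ← FreeGroup.mul_mk, h, inv_mul_cancel]

theorem val_eq_one_of_isRotated {c c' : Word S} (hr : c ~r c') (h : val R c = 1) :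
    val R c' = 1 := by
  obtain ⟨p, q, hc, hc'⟩ := exists_append_of_isRotated hr
  rw [hc, val_append, mul_eq_one_iff_eq_inv'] at h
  rw [hc', val_append, h, inv_mul_cancel]

theorem val_eq_one {c : Word S} (hc : c ∈ symClosure R) : val R c = 1 := by
  obtain ⟨r, hr, h⟩ := hc
  have h0 : val R r = 1 := PresentedGroup.one_of_mem ⟨r, hr, rfl⟩
  rcases h with h | h
  · exact val_eq_one_of_isRotated h.symm h0
  · exact val_eq_one_of_isRotated h.symm (by rw [val_invRev, h0, inv_one])

theorem CPrime.cycRed {lam : ℝ} (hR : CPrime R lam) {c : Word S} (hc : c ∈ symClosure R) :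
    CycRed c := by
  obtain ⟨r, hr, h | h⟩ := hc
  · exact (CycRed.of_isCyclicallyReduced (hR.1 r hr)).of_isRotated h.symm
  · exact (CycRed.of_isCyclicallyReduced (hR.1 r hr)).invRev.of_isRotated h.symm

theorem CPrime.six_mul_length_lt (hR : CPrime R (1 / 6)) {c c' u : Word S}
    (hc : c ∈ symClosure R) (hc' : c' ∈ symClosure R) (hne : c ≠ c') (hu : u <+: c)
    (hu' : u <+: c') : 6 * u.length < c.length := by
  have h := hR.2 c hc u ⟨c, hc, c', hc', hne, hu, hu'⟩ hu.isInfix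
  have : (6 * u.length : ℝ) < c.length := by linarith
  exact_mod_cast this

/-- `g` is a word of minimal length among those representing the same element of `⟨S | R⟩`. -/
def IsShortest (R : Set (Word S)) (g : Word S) : Prop :=
  ∀ g', val R g' = val R g → g.length ≤ g'.length

theorem IsShortest.of_infix {g u : Word S} (hg : IsShortest R g) (hu : u <:+: g) :
    IsShortest R u := by
  obtain ⟨p, q, rfl⟩ := hu
  intro u' h
  have := hg (p ++ u' ++ q) (by simp only [val_append, h])
  simp only [List.length_append] at this
  omega

theorem IsShortest.eq_nil {g : Word S} (hg : IsShortest R g) (h : val R g = 1) : g = [] :=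
  List.length_eq_zero_iff.1 (Nat.le_zero.1 (hg [] (by rw [h, val_nil])))

/-- A shortest word contains at most half of a relator, the other part of which is an alternative to
the part contained. -/
theorem IsShortest.two_mul_length_le {g u c : Word S} (hg : IsShortest R g) (hu : u <:+: g)
    (hc : c ∈ symClosure R) (hu' : u <:+: c) : 2 * u.length ≤ c.length := by
  obtain ⟨p, q, rfl⟩ := hu'
  have h1 : val R (p ++ u ++ q) = 1 := val_eq_one hc
  have h2 : val R (FreeGroup.invRev (q ++ p)) = val R u := by
    rw [val_invRev, val_append]
    rw [val_append, val_append] at h1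
    have h3 : val R u = (val R p)⁻¹ * (val R p * val R u * val R q) * (val R q)⁻¹ := by group
    rw [h3, h1]
    group
  have := hg.of_infix hu _ h2
  simp at this ⊢
  omega

end

end

/-! ### The length of a run -/

section

variable {S : Type*}

theorem invRev_infix {u v : Word S} (h : u <:+: v) :
    FreeGroup.invRev u <:+: FreeGroup.invRev v := by
  obtain ⟨p, q, rfl⟩ := h
  exact ⟨FreeGroup.invRev q, FreeGroup.invRev p, by simp⟩

/-- A contiguous part `h :: t` of the cyclic word `u ++ v` lies in `u` or in `v` unless `t` passes
through the beginning of `u` or of `v`. -/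
theorem infix_or_infix {α : Type*} {u v m t : List α} {h : α} (hr : (u ++ v) ~r (m ++ h :: t))
    (hu : ∀ x ∈ u.head?, x ∉ t) (hv : ∀ x ∈ v.head?, x ∉ t) :
    (h :: t) <:+: u ∨ (h :: t) <:+: v := by
  have key : ∀ p q, u ++ v = p ++ (h :: t) ++ q → (h :: t) <:+: u ∨ (h :: t) <:+: v := by
    intro p q hpq
    rw [List.append_assoc, List.cons_append] at hpq
    rcases append_eq_append_cons hpq with ⟨s, rfl, hs⟩ | ⟨s, rfl, rfl⟩
    · rcases List.append_eq_append_iff.1 hs with ⟨k, rfl, rfl⟩ | ⟨k, rfl, hk⟩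
      · exact .inl ⟨p, k, by simp⟩
      · rcases k with _ | ⟨b, k⟩
        · exact .inl ⟨p, [], by simp⟩
        · rw [hk] at hv
          exact absurd (by simp) (hv b (by simp))
    · exact .inr ⟨s, q, by simp⟩
  obtain ⟨p, q, hpq, hqp⟩ := exists_append_of_isRotated hr
  rcases append_eq_append_cons hqp.symm with ⟨s, rfl, rfl⟩ | ⟨s, rfl, rfl⟩
  · rcases p with _ | ⟨b, p⟩
    · exact key m [] (by simpa using hpq)
    · rcases u with _ | ⟨c, u⟩
      · rw [List.nil_append] at hpq
        rw [hpq] at hv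
        exact absurd (by simp) (hv b (by simp))
      · rw [List.cons_append, List.cons_append, List.cons.injEq] at hpq
        obtain ⟨rfl, -⟩ := hpq
        exact absurd (by simp) (hu c (by simp))
  · exact key s q (by simpa using hpq)

/-- The reversal of a dart, which is a letter together with a number that identifies the edge. -/
abbrev flip : ℕ × (S × Bool) → ℕ × (S × Bool) := Prod.map id bar

theorem flip_involutive : Function.Involutive (flip (S := S)) := fun d => by
  simp [flip, Prod.map, bar_involutive d.2]

theorem flip_ne (d : ℕ × (S × Bool)) : flip d ≠ d := fun h => by
  simpa [flip, bar] using congrArg (fun x => x.2.2) h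

theorem map_snd_flip (s : List (ℕ × (S × Bool))) :
    (s.map flip).reverse.map Prod.snd = FreeGroup.invRev (s.map Prod.snd) := by
  simp [FreeGroup.invRev, flip, bar, Function.comp_def]

section Bigon
variable {R : Set (Word S)} (hR : CPrime R (1 / 6)) {w g : Word S}
  (hwR : ∀ r ∈ symClosure R, ∀ u : Word S, u <:+: w → u <:+: r → 3 * u.length ≤ r.length)
  (hg : IsShortest R g)
  {W K : List (ℕ × (S × Bool))} {F : Multiset (List (ℕ × (S × Bool)))}
  (hW : W.map Prod.snd = w) (hK : K.map Prod.snd = FreeGroup.invRev g)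
  (hD : Diagram flip (W ++ K) F) (hn : (darts (W ++ K) F).Nodup)
  (hF : ∀ c ∈ F, c.map Prod.snd ∈ symClosure R)
  (hmin : ∀ m < F.card, ¬ ConjProd R m (FreeGroup.mk (w ++ FreeGroup.invRev g)))
  (hred : ∀ f ∈ (W ++ K) ::ₘ F, ∀ d l, ¬ f ~r (d :: flip d :: l))
  {V : Type} {ν : ℕ × (S × Bool) → V} (hν : ∀ f ∈ (W ++ K) ::ₘ F, ∃ b, Walk flip ν b f b)

open Classical in
include hR hW hK hD hn hF hmin hred hν in
/-- A path along a face, with interior vertices of degree `2` and with an interior edge at its end,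
is labelled by a piece, since the diagram has the least possible number of faces. -/
theorem interior_run {c s rest : List (ℕ × (S × Bool))} {d : ℕ × (S × Bool)} (hc : c ∈ F)
    (hr : c ~r (s ++ d :: rest))
    (hs : ∀ x ∈ s, ¬ 3 ≤ (darts (W ++ K) F).countP (fun y => ν y = ν (flip x)))
    (hd : flip d ∉ W ++ K) : 6 * (s.length + 1) < c.length := by
  obtain ⟨f, hf, m, hm⟩ := exists_mirror flip_involutive flip_ne hn
    (hD.bar_mem_darts flip_involutive) hν hred (Multiset.mem_cons_of_mem hc) s d rest hr hs
  have hfF : f ∈ F := by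
    refine (Multiset.mem_cons.1 hf).resolve_left ?_
    rintro rfl
    exact hd (hm.mem_iff.2 (by simp))
  have hr1 := hr.map Prod.snd
  have hm1 := isRotated_invRev (hm.map Prod.snd)
  rw [List.map_append, map_snd_flip, invRev_append, FreeGroup.invRev_invRev] at hm1
  have h1 := symClosure_of_isRotated hr1 (hF c hc)
  have h2 := symClosure_of_isRotated hm1 (invRev_mem_symClosure (hF f hfF))
  -- the two boundary words, both read from the beginning of the path in the direction of the path
  by_cases h : (s ++ d :: rest).map Prod.snd =
      (s ++ [d]).map Prod.snd ++ FreeGroup.invRev (m.map Prod.snd)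
  · -- the two faces are mirror images of each other
    exfalso
    by_cases hcf : c = f
    · -- a face is not its own mirror image
      subst hcf
      refine (hR.cycRed (hF c hc)).not_isRotated_invRev ?_ (hr1.trans (h ▸ hm1.symm))
      intro h0
      have := hr1.perm.length_eq
      simp [h0] at this
    · -- merging them gives a face with trivial boundary label, so that there was a smaller diagram
      obtain ⟨F', rfl⟩ := Multiset.exists_cons_of_mem hc
      obtain ⟨F', rfl⟩ := Multiset.exists_cons_of_mem
        ((Multiset.mem_cons.1 hfF).resolve_left (Ne.symm hcf))
      obtain ⟨k, hk, hkD⟩ := hD.merge flip_involutive rfl hn (d := d) (s := rest ++ s)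
        (s' := (s.map flip).reverse ++ m) (hr.trans (isRotated_swap s (d :: rest)))
        (hm.trans (isRotated_swap m (flip d :: (s.map flip).reverse)))
      have hk1 : FreeGroup.mk (k.map Prod.snd) = 1 := by
        refine mk_eq_one_of_isRotated (hk.map Prod.snd).symm ?_
        have h3 : rest.map Prod.snd = FreeGroup.invRev (m.map Prod.snd) := by
          have := h
          simp only [List.map_append, List.map_cons, List.append_assoc, List.map_nil,
            List.cons_append, List.nil_append, List.append_cancel_left_eq, List.cons.injEq,
            true_and] at this
          exact this
        rw [List.map_append, List.map_append, List.map_append, map_snd_flip, h3]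
        simp only [← FreeGroup.mul_mk, ← FreeGroup.inv_mk]
        group
      have hC := (hkD.map Prod.snd (e' := bar) fun _ => rfl).conjProd (R := R) (by
        intro x hx
        rw [Multiset.map_cons] at hx
        rcases Multiset.mem_cons.1 hx with rfl | hx
        · exact .inl hk1
        · obtain ⟨y, hy, rfl⟩ := Multiset.mem_map.1 hx
          exact .inr (hF y (by simp [hy])))
      rw [Multiset.map_cons, Multiset.countP_cons, if_neg (by simpa using hk1), List.map_append, hW,
        hK] at hC
      refine hmin _ ?_ hC
      have := Multiset.countP_le_card (fun c => FreeGroup.mk c ≠ 1) (F'.map (List.map Prod.snd))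
      simp at this ⊢
      omega
  · have := hR.six_mul_length_lt h1 h2 h (u := (s ++ [d]).map Prod.snd)
      ⟨rest.map Prod.snd, by simp⟩ ⟨_, rfl⟩
    have hl := hr.perm.length_eq
    simp at this hl
    omega

open Classical in
include hD hn hred hν in
/-- A path along a face whose interior vertices are of degree `2` and different from the two corners
of the bigon, and whose last edge is an exterior edge, runs along one side of the bigon. -/
theorem exterior_run {c s rest : List (ℕ × (S × Bool))} {d : ℕ × (S × Bool)} (hc : c ∈ F)
    (hr : c ~r (s ++ d :: rest))
    (hs : ∀ x ∈ s, ¬ 3 ≤ (darts (W ++ K) F).countP (fun y => ν y = ν (flip x)))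
    (hsW : ∀ x ∈ s, flip x ∉ W.head?) (hsK : ∀ x ∈ s, flip x ∉ K.head?)
    (hd : flip d ∈ W ++ K) :
    ((s ++ [d]).map flip).reverse <:+: W ∨ ((s ++ [d]).map flip).reverse <:+: K := by
  obtain ⟨f, hf, m, hm⟩ := exists_mirror flip_involutive flip_ne hn
    (hD.bar_mem_darts flip_involutive) hν hred (Multiset.mem_cons_of_mem hc) s d rest hr hs
  obtain rfl : f = W ++ K := eq_of_mem_of_mem hn hf (Multiset.mem_cons_self _ _)
    (hm.mem_iff.2 (by simp)) hd
  rw [List.map_append, List.reverse_append, List.map_singleton, List.reverse_singleton,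
    List.singleton_append] at hm ⊢
  refine infix_or_infix hm ?_ ?_
  · intro x hx hxs
    simp only [List.mem_reverse, List.mem_map] at hxs
    obtain ⟨y, hy, rfl⟩ := hxs
    exact hsW y hy hx
  · intro x hx hxs
    simp only [List.mem_reverse, List.mem_map] at hxs
    obtain ⟨y, hy, rfl⟩ := hxs
    exact hsK y hy hx

/-- A path along a face, traversed backwards, is labelled by a subword of a relator. -/
theorem infix_relator {c s rest : List (ℕ × (S × Bool))} (hc : c.map Prod.snd ∈ symClosure R)
    (hr : c ~r (s ++ rest)) :
    ∃ r ∈ symClosure R, r.length = c.length ∧ (s.map flip).reverse.map Prod.snd <:+: r ∧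
      FreeGroup.invRev ((s.map flip).reverse.map Prod.snd) <:+: FreeGroup.invRev r := by
  have hr1 := hr.map Prod.snd
  refine ⟨_, invRev_mem_symClosure (symClosure_of_isRotated hr1 hc), ?_, ?_, ?_⟩
  · simpa [add_comm] using hr.perm.length_eq.symm
  · rw [map_snd_flip]
    exact invRev_infix ⟨[], rest.map Prod.snd, by simp⟩
  · rw [map_snd_flip]
    exact invRev_infix (invRev_infix ⟨[], rest.map Prod.snd, by simp⟩)

include hwR hW hF in
/-- A path along a face and along the side `w` covers at most a third of the face. -/
theorem three_mul_length_le {c s rest : List (ℕ × (S × Bool))} (hc : c ∈ F)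
    (hr : c ~r (s ++ rest)) (h : (s.map flip).reverse <:+: W) : 3 * s.length ≤ c.length := by
  obtain ⟨r, hrR, hrl, hi, -⟩ := infix_relator (hF c hc) hr
  have := hwR r hrR _ (hW ▸ h.map Prod.snd) hi
  simp at this
  omega

include hg hK hF in
/-- A path along a face and along the geodesic side covers at most half of the face. -/
theorem two_mul_length_le {c s rest : List (ℕ × (S × Bool))} (hc : c ∈ F)
    (hr : c ~r (s ++ rest)) (h : (s.map flip).reverse <:+: K) : 2 * s.length ≤ c.length := by
  obtain ⟨r, hrR, hrl, -, hi⟩ := infix_relator (hF c hc) hr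
  have h1 := invRev_infix (h.map Prod.snd)
  rw [hK, FreeGroup.invRev_invRev] at h1
  have := hg.two_mul_length_le h1 (invRev_mem_symClosure hrR) hi
  simp at this
  omega

end Bigon

end

/-! ### Faces have nonpositive curvature -/

section

variable {S : Type*} {R : Set (Word S)}

/-- A path labelled by the inverse of a shortest word does not visit a vertex twice. -/
theorem IsShortest.length_eq_of_prefix {g p p' : Word S} (hg : IsShortest R g)
    (hp : p <+: FreeGroup.invRev g) (hp' : p' <+: FreeGroup.invRev g) (h : val R p = val R p') :
    p.length = p'.length := by
  have key : ∀ p p' : Word S, p' <+: FreeGroup.invRev g → p <+: p' → val R p = val R p' →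
      p = p' := by
    rintro p _ hp' ⟨k, rfl⟩ h
    rw [val_append, left_eq_mul] at h
    have h1 : k <:+: FreeGroup.invRev g := .trans ⟨p, [], by simp⟩ hp'.isInfix
    have h2 := invRev_infix h1
    rw [FreeGroup.invRev_invRev] at h2
    have h3 := (hg.of_infix h2).eq_nil (by rw [val_invRev, h, inv_one])
    have h4 : k = [] := by simpa [FreeGroup.invRev] using h3
    rw [h4, List.append_nil]
  rcases List.prefix_or_prefix_of_prefix hp hp' with h' | h'
  · rw [key p p' hp' h' h]
  · rw [key p' p hp h' h.symm]

theorem Walk.end_eq {α V : Type*} {e : α → α} {ν : α → V} {u : List α} {a : α} {b c : V}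
    (h : Walk e ν b (u ++ [a]) c) : c = ν (e a) := by
  obtain ⟨m, -, h⟩ := Walk.append_iff.1 h
  exact h.2.symm

section Bigon
variable (hR : CPrime R (1 / 6)) {w g : Word S}
  (hwR : ∀ r ∈ symClosure R, ∀ u : Word S, u <:+: w → u <:+: r → 3 * u.length ≤ r.length)
  (hg : IsShortest R g)
  {W K : List (ℕ × (S × Bool))} {F : Multiset (List (ℕ × (S × Bool)))}
  (hW : W.map Prod.snd = w) (hK : K.map Prod.snd = FreeGroup.invRev g)
  (hD : Diagram flip (W ++ K) F) (hn : (darts (W ++ K) F).Nodup)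
  (hF : ∀ c ∈ F, c.map Prod.snd ∈ symClosure R)
  (hmin : ∀ m < F.card, ¬ ConjProd R m (FreeGroup.mk (w ++ FreeGroup.invRev g)))
  (hred : ∀ f ∈ (W ++ K) ::ₘ F, ∀ d l, ¬ f ~r (d :: flip d :: l))
  {V : Type} {ν : ℕ × (S × Bool) → V} (hν : ∀ f ∈ (W ++ K) ::ₘ F, ∃ b, Walk flip ν b f b)
  {γ : V → Grp R} (hγ : ∀ d ∈ darts (W ++ K) F, γ (ν (flip d)) = γ (ν d) * letter R d.2)
  {b₀ : V} (hb₀ : Walk flip ν b₀ (W ++ K) b₀)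

include hg hK hν hγ hb₀ in
/-- Two consecutive paths along a face that both run along the geodesic side do so consecutively:
they meet in a vertex, and the geodesic side visits this vertex only once. -/
theorem append_infix {c s s' rest : List (ℕ × (S × Bool))} {d d' : ℕ × (S × Bool)} (hc : c ∈ F)
    (hr : c ~r (s ++ d :: (s' ++ d' :: rest)))
    (h : ((s ++ [d]).map flip).reverse <:+: K) (h' : ((s' ++ [d']).map flip).reverse <:+: K) :
    ((s ++ d :: (s' ++ [d'])).map flip).reverse <:+: K := by
  obtain ⟨p, q, hpq⟩ := h
  obtain ⟨p', q', hpq'⟩ := h'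
  obtain ⟨a, t, ht⟩ : ∃ a t, s' ++ [d'] = a :: t := by
    rcases s' with _ | ⟨a, s'⟩
    · exact ⟨d', [], rfl⟩
    · exact ⟨a, s' ++ [d'], rfl⟩
  obtain ⟨b, hb⟩ := hν c (Multiset.mem_cons_of_mem hc)
  have hturn : ν (flip d) = ν a := by
    refine hb.eq_of_isRotated (l := t ++ rest ++ s) ?_
    refine hr.trans ?_
    rw [show s' ++ d' :: rest = (s' ++ [d']) ++ rest by simp, ht]
    exact isRotated_swap s (d :: a :: (t ++ rest))
  obtain ⟨m, -, hKw⟩ := Walk.append_iff.1 hb₀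
  have hγK : ∀ x ∈ K, γ (ν (flip x)) = γ (ν x) * letter R x.2 := fun x hx =>
    hγ x (mem_darts.2 (by simp [hx]))
  have h1 : γ (ν (flip d)) = γ m * val R (p.map Prod.snd) := by
    have := hKw
    rw [← hpq, List.append_assoc] at this
    obtain ⟨x, hx, hx'⟩ := Walk.append_iff.1 this
    rw [List.map_append, List.reverse_append] at hx'
    rw [hx'.1, hx.prod_eq (lab := fun d => letter R d.2)
      fun y hy => hγK y (by rw [← hpq]; simp [hy]), ← prod_letter, List.map_map]
    rfl
  have h2 : γ (ν a) = γ m *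
      val R ((p' ++ ((s' ++ [d']).map flip).reverse).map Prod.snd) := by
    have := hKw
    rw [← hpq'] at this
    obtain ⟨x, hx, -⟩ := Walk.append_iff.1 this
    have hxa : x = ν a := by
      rw [ht, List.map_cons, List.reverse_cons, ← List.append_assoc] at hx
      rw [hx.end_eq, flip_involutive a]
    rw [← hxa, hx.prod_eq (lab := fun d => letter R d.2)
      fun y hy => hγK y (by rw [← hpq', List.mem_append]; exact .inl hy),
      ← prod_letter (List.map _ _), List.map_map]
    rfl
  have h3 : val R (p.map Prod.snd) =
      val R ((p' ++ ((s' ++ [d']).map flip).reverse).map Prod.snd) :=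
    mul_left_cancel (h1.symm.trans ((congrArg γ hturn).trans h2))
  have h4 := hg.length_eq_of_prefix
    (by rw [← hK, ← hpq, List.append_assoc]; exact (List.prefix_append _ _).map _)
    (by rw [← hK, ← hpq']; exact (List.prefix_append _ _).map _) h3
  rw [List.length_map, List.length_map] at h4
  have h5 := hpq.trans hpq'.symm
  rw [List.append_assoc] at h5
  have h6 := (List.append_inj h5 h4).2
  refine ⟨p', q, ?_⟩
  rw [← hpq', ← h6]
  simp

/-- In a list of ends of runs let `x` be the number of those on the side `W`, `y` the number of
those on the side `K` and `i` the number of the others. A bound `a`, `b` or `k` for each run of the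
respective kind gives the total bound `x * a + y * b + i * k`. -/
theorem exists_counts {α : Type*} (W K : α → Prop) [DecidablePred W] [DecidablePred K] (a b k : ℕ)
    (l : List α) : ∃ i x y, l.length = i + x + y ∧
      l.countP (fun d => W d ∨ K d) = x + y ∧ (i = 0 → ∀ d ∈ l, W d ∨ K d) ∧
      (x = 0 → ∀ d ∈ l, ¬ W d) ∧ l.countP (fun d => ¬ (W d ∨ K d)) = i ∧
      (l.map fun d => if W d then a else if K d then b else k).sum = x * a + y * b + i * k := by
  induction l with
  | nil => exact ⟨0, 0, 0, by simp⟩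
  | cons d l ih =>
    obtain ⟨i, x, y, h1, h2, h3, h4, h5, h6⟩ := ih
    by_cases hW : W d
    · refine ⟨i, x + 1, y, ?_⟩
      simp only [List.countP_cons, hW, h2, h5, List.map_cons, List.sum_cons, h6, List.length_cons]
      refine ⟨by omega, by simp; omega, by simpa [hW] using h3, by simp, by simp, by simp; ring⟩
    · by_cases hK : K d
      · refine ⟨i, x, y + 1, ?_⟩
        simp only [List.countP_cons, hW, hK, h2, h5, List.map_cons, List.sum_cons, h6,
          List.length_cons]
        refine ⟨by omega, by simp; omega, by simpa [hW, hK] using h3, by simpa [hW] using h4,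
          by simp, by simp; ring⟩
      · refine ⟨i + 1, x, y, ?_⟩
        simp only [List.countP_cons, hW, hK, h2, h5, List.map_cons, List.sum_cons, h6,
          List.length_cons]
        refine ⟨by omega, by simp, by simp, by simpa [hW] using h4, by simp, by simp; ring⟩

theorem not_of_countP_eq_one {α : Type*} {p : α → Prop} [DecidablePred p] {a b x : α} (hx : p x)
    (h : [a, b, x].countP (fun d => p d) = 1) : ¬ p a ∧ ¬ p b := by
  constructor <;> intro ha <;> simp only [List.countP_cons, List.countP_nil, ha, hx,
    decide_true, if_true] at h <;> omega

/-- The arithmetic of a face of length `L` with `n` runs on the side `w`, `m` runs on the geodesic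
side and `i` interior runs: if the exterior runs count twice and the total is less than six, then the
bounds for the lengths leave only the case of two runs on the geodesic side. -/
theorem eq_zero_and_eq_two_of_lt {L n m i : ℕ} (hL : 0 < L)
    (h : 6 * L ≤ n * (2 * L) + m * (3 * L) + i * (L - 1)) (hlt : i + 2 * n + 2 * m < 6) :
    n = 0 ∧ m = 2 ∧ i ≤ 1 := by
  have hn : n ≤ 2 := by omega
  have hm : m ≤ 2 := by omega
  have hi : i ≤ 5 := by omega
  interval_cases n <;> interval_cases m <;> interval_cases i <;> omega

open Classical in
include hR hwR hg hW hK hD hn hF hmin hred hν hγ hb₀ in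
/-- Every face has nonpositive curvature: if its boundary path is cut into `n` runs, which end at
the darts satisfying `E`, and `m` of them lie on the exterior, then `6 ≤ n + m`. The hypotheses on
`E` say that every vertex of degree at least `3` and every corner of the bigon is a cut. -/
theorem six_le_countP (E : ℕ × (S × Bool) → Prop)
    (hE : ∀ x, ¬ E x → ¬ 3 ≤ (darts (W ++ K) F).countP (fun y => ν y = ν (flip x)))
    (hEW : ∀ x, ¬ E x → flip x ∉ W.head?) (hEK : ∀ x, ¬ E x → flip x ∉ K.head?)
    {c : List (ℕ × (S × Bool))} (hc : c ∈ F) (hc0 : c ≠ []) :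
    6 ≤ c.countP E + c.countP (fun d => flip d ∈ W ++ K ∧ E d) := by
  have hL : 0 < c.length := List.length_pos_iff.2 hc0
  have hdisj : ∀ d, d ∈ W → d ∉ K := fun d h h' =>
    List.disjoint_of_nodup_append (nodup_boundary hn) h h'
  have hrunK : ∀ s d rest, c ~r (s ++ d :: rest) → (∀ x ∈ s, ¬ E x) → flip d ∈ K →
      ((s ++ [d]).map flip).reverse <:+: K := by
    intro s d rest hr hs hd
    refine (exterior_run hD hn hred hν hc hr (fun x hx => hE x (hs x hx))
      (fun x hx => hEW x (hs x hx)) (fun x hx => hEK x (hs x hx)) (by simp [hd])).resolve_left ?_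
    intro h
    exact hdisj _ (h.subset (by simp)) hd
  have hrunW : ∀ s d rest, c ~r (s ++ d :: rest) → (∀ x ∈ s, ¬ E x) → flip d ∈ W →
      ((s ++ [d]).map flip).reverse <:+: W := by
    intro s d rest hr hs hd
    refine (exterior_run hD hn hred hν hc hr (fun x hx => hE x (hs x hx))
      (fun x hx => hEW x (hs x hx)) (fun x hx => hEK x (hs x hx)) (by simp [hd])).resolve_right ?_
    intro h
    exact hdisj _ hd (h.subset (by simp))
  have hrun : ∀ s d rest, c ~r (s ++ d :: rest) → (∀ x ∈ s, ¬ E x) →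
      6 * (s.length + 1) ≤ if flip d ∈ W then 2 * c.length else if flip d ∈ K then 3 * c.length
        else c.length - 1 := by
    intro s d rest hr hs
    have hr' : c ~r ((s ++ [d]) ++ rest) := by simpa using hr
    split_ifs with h1 h2
    · have := three_mul_length_le hwR hW hF hc hr' (hrunW s d rest hr hs h1)
      simp at this
      omega
    · have := two_mul_length_le hg hK hF hc hr' (hrunK s d rest hr hs h2)
      simp at this
      omega
    · have := interior_run hR hW hK hD hn hF hmin hred hν hc hr (fun x hx => hE x (hs x hx))
        (by simp [h1, h2])
      omega
  -- Start at the end of a run, of an interior one if possible: if there are two geodesic runs and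
  -- at most one interior run, then the geodesic ones are consecutive.
  obtain ⟨x, hxc, hx, hx'⟩ : ∃ x ∈ c, E x ∧
      ((∃ y ∈ c, E y ∧ flip y ∉ W ++ K) → flip x ∉ W ++ K) := by
    by_cases h : ∃ y ∈ c, E y ∧ flip y ∉ W ++ K
    · obtain ⟨y, hy, h1, h2⟩ := h
      exact ⟨y, hy, h1, fun _ => h2⟩
    · by_contra! h'
      rcases List.eq_nil_or_concat c with rfl | ⟨s, d, hsd⟩
      · exact hc0 rfl
      · rw [List.concat_eq_append] at hsd
        have hnE : ∀ y ∈ c, ¬ E y := fun y hy hEy =>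
          absurd (h' y hy hEy).1 (by simpa using h)
        have := hrun s d [] (hsd ▸ .refl _) fun y hy => hnE y (by simp [hsd, hy])
        have hl : c.length = s.length + 1 := by simp [hsd]
        split_ifs at this <;> omega
  obtain ⟨t, ht⟩ := exists_isRotated_cons hxc
  have hr : c ~r (t ++ [x]) := ht.trans (isRotated_swap [x] t)
  have hlen := hr.perm.length_eq
  have hsum := length_le_sum_runs E (fun d => if flip d ∈ W then 2 * c.length else
    if flip d ∈ K then 3 * c.length else c.length - 1) 6 (t ++ [x]) [] (by simp) (by
      rintro s d ⟨p, q, hpq⟩ hs _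
      refine hrun s d (q ++ p) (hr.trans ?_) hs
      rw [← List.nil_append (t ++ [x]), ← hpq]
      exact isRotated_swap p (s ++ d :: q)) (fun _ => rfl) (by simpa using hx)
  have hfil : (t ++ [x]).filter E = t.filter E ++ [x] := by simp [List.filter_append, hx]
  have hcount : c.countP E = ((t ++ [x]).filter E).length := by
    rw [hr.perm.countP_eq, List.countP_eq_length_filter]
  have hcount' : c.countP (fun d => flip d ∈ W ++ K ∧ E d) =
      ((t ++ [x]).filter E).countP (fun d => flip d ∈ W ∨ flip d ∈ K) := by
    rw [hr.perm.countP_eq, List.countP_filter]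
    simp
  have hmemc : ∀ y ∈ (t ++ [x]).filter E, y ∈ c ∧ E y := fun y hy => by
    rw [List.mem_filter] at hy
    exact ⟨hr.mem_iff.2 hy.1, by simpa using hy.2⟩
  obtain ⟨i, n, m, h1, h2, h3, h4, h5, h6⟩ := exists_counts (fun d => flip d ∈ W)
    (fun d => flip d ∈ K) (2 * c.length) (3 * c.length) (c.length - 1) ((t ++ [x]).filter E)
  rw [h6, ← hlen, List.length_nil, zero_add] at hsum
  rw [hcount, hcount', h2, h1]
  by_contra hlt
  have hcase := eq_zero_and_eq_two_of_lt hL hsum (by omega)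
  obtain ⟨rfl, rfl, hi⟩ := hcase
  -- two adjacent runs on the geodesic side together make up at most half of the face
  have hadj : ∀ s d s' d' rest, t ++ [x] = s ++ d :: (s' ++ d' :: rest) → (∀ y ∈ s, ¬ E y) →
      (∀ y ∈ s', ¬ E y) → flip d ∈ K → flip d' ∈ K →
      2 * (s.length + s'.length + 2) ≤ c.length := by
    intro s d s' d' rest h hs hs' hd hd'
    rw [h] at hr
    have hr2 : c ~r (s' ++ d' :: (rest ++ (s ++ [d]))) := hr.trans (by
      simpa using isRotated_swap (s ++ [d]) (s' ++ d' :: rest))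
    have := append_infix hg hK hν hγ hb₀ hc hr (hrunK _ _ _ hr hs hd) (hrunK _ _ _ hr2 hs' hd')
    have := two_mul_length_le hg hK hF hc (rest := rest) (by simpa using hr) this
    simp at this
    omega
  have hnil : ∀ p l : List (ℕ × (S × Bool)), t ++ [x] = p ++ l → l.filter E = [] → l = [] := by
    intro p l h hl
    rcases List.eq_nil_or_concat l with rfl | ⟨l, y, rfl⟩
    · rfl
    · rw [List.concat_eq_append, ← List.append_assoc] at h
      obtain rfl : x = y := by simpa using (List.append_inj' h rfl).2
      rw [List.concat_eq_append] at hl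
      simp [List.filter_append, hx] at hl
  obtain ⟨d, l, hdl⟩ : ∃ d l, (t ++ [x]).filter E = d :: l := by
    rcases h : (t ++ [x]).filter E with _ | ⟨d, l⟩
    · rw [h] at h1; simp at h1
    · exact ⟨d, l, h⟩
  obtain ⟨d', l', hdl'⟩ : ∃ d l', l = d :: l' := by
    rcases l with _ | ⟨d, l⟩
    · rw [hdl] at h1; simp at h1
    · exact ⟨d, l, rfl⟩
  subst hdl'
  obtain ⟨s, l₁, hs, hs', hE1, hl₁⟩ := List.filter_eq_cons_iff.1 hdl
  obtain ⟨s', l₂, rfl, hs'', hE2, hl₂⟩ := List.filter_eq_cons_iff.1 hl₁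
  simp only [decide_eq_true_eq] at hs' hs''
  have hlen2 := congrArg List.length hs
  rw [← hlen] at hlen2
  simp at hlen2
  rcases Nat.le_one_iff_eq_zero_or_eq_one.1 hi with rfl | rfl
  · -- no interior run: two geodesic runs would cover the face
    have hl' : l' = [] := by
      rw [hdl] at h1
      simpa using h1
    subst hl'
    have := hnil (s ++ d :: (s' ++ [d'])) l₂ (by simp [hs]) hl₂
    subst this
    have hd := (h3 rfl d (by simp [hdl])).resolve_left (h4 rfl d (by simp [hdl]))
    have hd' := (h3 rfl d' (by simp [hdl])).resolve_left (h4 rfl d' (by simp [hdl]))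
    have := hadj s d s' d' [] hs hs' hs'' hd hd'
    simp at hlen2
    omega
  · -- one interior run, which comes last
    obtain ⟨y, rfl⟩ : ∃ y, l' = [y] := by
      rw [hdl] at h1
      exact List.length_eq_one_iff.1 (by simpa using h1)
    obtain ⟨s₃, l₃, rfl, hs3, hE3, hl₃⟩ := List.filter_eq_cons_iff.1 hl₂
    simp only [decide_eq_true_eq] at hs3
    have := hnil (s ++ d :: (s' ++ d' :: (s₃ ++ [y]))) l₃ (by simp [hs]) hl₃
    subst this
    obtain rfl : x = y := by
      have : t ++ [x] = (s ++ d :: (s' ++ d' :: s₃)) ++ [y] := by simp [hs]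
      simpa using (List.append_inj' this rfl).2
    have hxint : flip x ∉ W ++ K := by
      apply hx'
      obtain ⟨y, hy, hy'⟩ := List.countP_pos_iff.1 (show 0 < List.countP _ _ by rw [h5]; simp)
      exact ⟨y, (hmemc y hy).1, (hmemc y hy).2, by simpa using hy'⟩
    have hKd : flip d ∈ K ∧ flip d' ∈ K := by
      rw [hdl] at h4 h5
      obtain ⟨ha, hb⟩ := not_of_countP_eq_one (by simpa using hxint) h5
      exact ⟨(not_not.1 ha).resolve_left (h4 rfl d (by simp)),
        (not_not.1 hb).resolve_left (h4 rfl d' (by simp))⟩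
    have h7 := hadj s d s' d' (s₃ ++ [x]) hs hs' hs'' hKd.1 hKd.2
    have h8 := hrun s₃ x (s ++ d :: (s' ++ [d'])) (by
      refine hr.trans ?_
      rw [hs]
      exact isRotated_swap (s ++ d :: (s' ++ [d'])) (s₃ ++ [x])) hs3
    simp only [List.mem_append, not_or] at hxint
    rw [if_neg hxint.1, if_neg hxint.2] at h8
    simp at hlen2
    omega

end Bigon

end

/-! ### Uniqueness of shortest words, and distances in the Cayley graph -/

section

/-- A closed path visits a set of vertices as often with the ends of its edges as with their
beginnings. -/
theorem Walk.countP_eq {α V : Type*} {e : α → α} {ν : α → V} (p : V → Prop) [DecidablePred p]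
    {z : List α} {b : V} (h : Walk e ν b z b) :
    z.countP (fun d => p (ν (e d))) = z.countP (fun d => p (ν d)) := by
  have key : ∀ (z : List α) (b c : V), Walk e ν b z c →
      z.countP (fun d => p (ν d)) + (if p c then 1 else 0) =
        z.countP (fun d => p (ν (e d))) + (if p b then 1 else 0) := by
    intro z
    induction z with
    | nil => rintro b _ rfl; rfl
    | cons d z ih =>
      rintro _ c ⟨rfl, h⟩
      have := ih _ _ h
      simp only [List.countP_cons, decide_eq_true_eq]
      omega
  have := key z b b h
  omega

theorem Diagram.face_ne_nil {α : Type*} {e : α → α} {z : List α} {f : Multiset (List α)}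
    (h : Diagram e z f) : ∀ c ∈ f, c ≠ [] := by
  induction h with
  | nil => simp
  | rot _ _ ih => exact ih
  | bridge x _ _ ih1 ih2 =>
    intro c hc
    rcases Multiset.mem_add.1 hc with hc | hc
    · exact ih1 c hc
    · exact ih2 c hc
  | cell x _ ih => simpa using ih

theorem countP_sum_faces {α : Type*} (p : α → Prop) [DecidablePred p] (F : Multiset (List α)) :
    (F.map Multiset.ofList).sum.countP p = (F.map fun c => c.countP p).sum := by
  induction F using Multiset.induction_on with
  | empty => simp
  | cons c F ih => simp [Multiset.countP_add, ih]

variable {S : Type*} {R : Set (Word S)}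

open Classical in
/-- There is no nontrivial bigon with a side containing at most a third of any relator and a
geodesic side: its faces have nonpositive curvature, and its two corners do not provide the total
curvature of a disc. -/
theorem no_bigon (hR : CPrime R (1 / 6)) {w g : Word S}
    (hwR : ∀ r ∈ symClosure R, ∀ u : Word S, u <:+: w → u <:+: r → 3 * u.length ≤ r.length)
    (hg : IsShortest R g) (hred : CycRed (w ++ FreeGroup.invRev g))
    (h0 : w ++ FreeGroup.invRev g ≠ []) (hval : val R w = val R g) : False := by
  have hex : ∃ n, ConjProd R n (FreeGroup.mk (w ++ FreeGroup.invRev g)) := by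
    apply ConjProd.exists_of_mk_eq_one
    change val R (w ++ FreeGroup.invRev g) = 1
    rw [val_append, val_invRev, hval, mul_inv_cancel]
  obtain ⟨f, hf, hfn, hfR⟩ := Diagram.exists_of_conjProd hred.isReduced (Nat.find_spec hex)
  obtain ⟨-, Z, F, hD, hZ, rfl, hn, -, -⟩ := hf.exists_lift (fun a h => by
    simpa [bar] using congrArg Prod.snd h) 0
  obtain ⟨W, K, rfl, hW, hK⟩ := List.map_eq_append_iff.1 hZ
  change Diagram flip (W ++ K) F at hD
  rw [Multiset.card_map] at hfn
  have hF : ∀ c ∈ F, c.map Prod.snd ∈ symClosure R := fun c hc =>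
    hfR _ (Multiset.mem_map_of_mem _ hc)
  have hmin : ∀ m < F.card, ¬ ConjProd R m (FreeGroup.mk (w ++ FreeGroup.invRev g)) :=
    fun m hm => Nat.find_min hex (hm.trans_le hfn)
  have hredD : ∀ f ∈ (W ++ K) ::ₘ F, ∀ d l, ¬ f ~r (d :: flip d :: l) := by
    intro f hf d l hr
    have hc : CycRed (f.map Prod.snd) := by
      rcases Multiset.mem_cons.1 hf with rfl | hf
      · rwa [hZ]
      · exact hR.cycRed (hF f hf)
    exact hc d.2 (l.map Prod.snd) (hr.map Prod.snd)
  have hZ0 : W ++ K ≠ [] := by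
    intro h
    rw [h] at hZ
    exact h0 hZ.symm
  obtain ⟨V, _, ν, γ, b, hb, hν, hV, hγ, hcard⟩ := hD.exists_vertices flip_involutive
    (lab := fun d => letter R d.2) (fun d => letter_bar d.2) hn (by
      intro c hc
      have := val_eq_one (hF c hc)
      rwa [← prod_letter, List.map_map] at this)
  have hν' : ∀ f ∈ (W ++ K) ::ₘ F, ∃ b, Walk flip ν b f b := by
    intro f hf
    rcases Multiset.mem_cons.1 hf with rfl | hf
    · exact ⟨b, hb⟩
    · exact hν f hf
  have hcl := hD.bar_mem_darts flip_involutive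
  have hhit : ∀ v, ∃ d ∈ darts (W ++ K) F, ν d = v := by
    intro v
    rcases hV v with rfl | h
    · rcases h : W ++ K with _ | ⟨d, z⟩
      · exact absurd h hZ0
      · rw [h] at hb
        exact ⟨d, mem_darts.2 (by simp), hb.1⟩
    · exact h
  have hdeg : ∀ v, 2 ≤ (darts (W ++ K) F).countP (fun d => ν d = v) := by
    intro v
    obtain ⟨d, hd, rfl⟩ := hhit v
    exact two_le_degree flip_ne hcl hν' hredD hd
  -- the corners of the bigon: the vertices at which one of the sides begins
  let J : Finset V := ((W.head?.toList ++ K.head?.toList).map ν).toFinset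
  have hJ : J.card ≤ 2 := by
    refine (List.toFinset_card_le _).trans ?_
    rcases W with _ | ⟨_, _⟩ <;> rcases K with _ | ⟨_, _⟩ <;> simp
  have hJW : ∀ d ∈ W.head?, ν d ∈ J := fun d hd => by
    simp only [J, List.mem_toFinset, List.mem_map]
    exact ⟨d, by simp_all, rfl⟩
  have hJK : ∀ d ∈ K.head?, ν d ∈ J := fun d hd => by
    simp only [J, List.mem_toFinset, List.mem_map]
    exact ⟨d, by simp_all, rfl⟩
  -- runs are cut at the corners and at the vertices of degree at least `3`
  obtain ⟨big, hbig, hGB⟩ : ∃ big : V → Prop,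
      (∀ v, v ∈ J ∨ 3 ≤ (darts (W ++ K) F).countP (fun d => ν d = v) → big v) ∧
      (darts (W ++ K) F).countP (fun d => big (ν d)) + 6 ≤ 6 * F.card + 2 * J.card := by
    refine ⟨_, fun _ => id, ?_⟩
    convert countP_add_six_le ν _ J F.card hcard hdeg
  have hface : ∀ c ∈ F, 6 ≤ c.countP (fun d => big (ν (flip d))) +
      c.countP (fun d => flip d ∈ W ++ K ∧ big (ν (flip d))) := by
    intro c hc
    refine six_le_countP hR hwR hg hW hK hD hn hF hmin hredD hν' hγ hb
      (fun d => big (ν (flip d))) ?_ ?_ ?_ hc (hD.face_ne_nil c hc)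
    · exact fun x hx h => hx (hbig _ (.inr h))
    · exact fun x hx h => hx (hbig _ (.inl (hJW _ h)))
    · exact fun x hx h => hx (hbig _ (.inl (hJK _ h)))
  -- sum over all faces; `I` consists of the darts on faces, each of which ends a run if it leads to
  -- a cut
  set I := (F.map Multiset.ofList).sum with hI
  have hdarts : darts (W ++ K) F = ((W ++ K : List _) : Multiset _) + I := rfl
  have h1 : 6 * F.card ≤ I.countP (fun d => big (ν (flip d))) +
      I.countP (fun d => flip d ∈ W ++ K ∧ big (ν (flip d))) := by
    rw [hI, countP_sum_faces, countP_sum_faces, ← Multiset.sum_map_add]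
    have := Multiset.card_nsmul_le_sum (s := F.map fun c => c.countP (fun d => big (ν (flip d))) +
      c.countP (fun d => flip d ∈ W ++ K ∧ big (ν (flip d)))) (a := 6) (by simpa using hface)
    simpa [mul_comm] using this
  -- an exterior run of a face ends opposite to a boundary dart that begins at a cut
  have h2 : I.countP (fun d => flip d ∈ W ++ K ∧ big (ν (flip d))) ≤
      (W ++ K).countP (fun d => big (ν d)) := by
    have hle : (I.filter (fun d => flip d ∈ W ++ K ∧ big (ν (flip d)))).map flip ≤
        ((W ++ K : List _) : Multiset _).filter (fun d => big (ν d)) := by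
      rw [Multiset.le_iff_subset]
      · intro x hx
        obtain ⟨y, hy, rfl⟩ := Multiset.mem_map.1 hx
        have := (Multiset.mem_filter.1 hy).2
        exact Multiset.mem_filter.2 ⟨this.1, this.2⟩
      · rw [hdarts] at hn
        exact ((Multiset.nodup_add.1 hn).2.1.filter _).map flip_involutive.injective
    have := Multiset.card_le_card hle
    rwa [Multiset.card_map, ← Multiset.countP_eq_card_filter, ← Multiset.countP_eq_card_filter,
      Multiset.coe_countP] at this
  have h3 := hb.countP_eq big
  have h4 : (darts (W ++ K) F).countP (fun d => big (ν (flip d))) =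
      (darts (W ++ K) F).countP (fun d => big (ν d)) := by
    have hmap : (darts (W ++ K) F).map flip = darts (W ++ K) F := by
      refine (Multiset.Nodup.ext (hn.map flip_involutive.injective) hn).2 fun d => ?_
      rw [Multiset.mem_map]
      constructor
      · rintro ⟨d, hd, rfl⟩
        exact hcl d hd
      · exact fun hd => ⟨flip d, hcl d hd, flip_involutive d⟩
    conv_rhs => rw [← hmap, Multiset.countP_map, ← Multiset.countP_eq_card_filter]
  have h5 : (darts (W ++ K) F).countP (fun d => big (ν (flip d))) =
      (W ++ K).countP (fun d => big (ν (flip d))) + I.countP (fun d => big (ν (flip d))) := by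
    rw [hdarts, Multiset.countP_add, Multiset.coe_countP]
  omega

theorem IsShortest.isReduced {g : Word S} (hg : IsShortest R g) : FreeGroup.IsReduced g := by
  refine FreeGroup.IsReduced.of_forall_not_step fun g' hs => ?_
  have h1 := hg g' (by rw [val, val, FreeGroup.Red.exact.2 ⟨g', .refl, .single hs⟩])
  have := hs.length
  omega

/-- A reduced word containing at most a third of any relator is the unique shortest word
representing its element of the group. -/
theorem eq_of_val_eq (hR : CPrime R (1 / 6)) (n : ℕ) : ∀ {w g : Word S}, w.length + g.length ≤ n →
    FreeGroup.IsReduced w →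
    (∀ r ∈ symClosure R, ∀ u : Word S, u <:+: w → u <:+: r → 3 * u.length ≤ r.length) →
    IsShortest R g → val R w = val R g → w = g := by
  induction n with
  | zero =>
    intro w g h _ _ _ _
    rw [List.length_eq_zero_iff.1 (by omega : w.length = 0),
      List.length_eq_zero_iff.1 (by omega : g.length = 0)]
  | succ n ih =>
    intro w g hlen hw hwR hg hval
    have hinf : ∀ {w' g' : Word S}, w' <:+: w → g' <:+: g → w'.length < w.length →
        val R w' = val R g' → w' = g' := by
      intro w' g' h1 h2 h3 h4
      have := h2.length_le
      exact ih (by omega) (hw.infix h1) (fun r hr u hu => hwR r hr u (hu.trans h1))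
        (hg.of_infix h2) h4
    rcases w with _ | ⟨a, w⟩
    · exact (hg.eq_nil (by rw [← hval, val_nil])).symm
    obtain ⟨w₀, a', hw₀⟩ : ∃ w₀ a', a :: w = w₀ ++ [a'] := by
      rcases List.eq_nil_or_concat (a :: w) with h | ⟨w₀, a', h⟩
      · simp at h
      · exact ⟨w₀, a', by simpa using h⟩
    by_contra hne
    -- `x` and `y⁻¹` do not cancel if `x ≠ y`
    have hlet : ∀ x y : S × Bool, x ≠ y → (x.1 = (bar y).1 → x.2 = (bar y).2) := by
      rintro ⟨x, i⟩ ⟨y, j⟩ hxy (rfl : x = y)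
      have hij : i ≠ j := fun h => hxy (by rw [h])
      simpa [bar, Bool.eq_not] using hij
    refine no_bigon hR hwR hg (CycRed.of_isCyclicallyReduced ?_) (by simp) hval
    rcases g with _ | ⟨b, g⟩
    · -- Here `w` is a closed path. If its first and last letters cancel, the part between them is
      -- closed as well.
      simp only [FreeGroup.invRev_empty, List.append_nil]
      refine ⟨hw, ?_⟩
      intro x hx y hy h1
      rw [hw₀] at hx
      obtain rfl : a' = x := by simpa using hx
      obtain rfl : a = y := by simpa using hy
      by_contra h2
      have hab : a' = bar a := by
        by_contra h3
        exact h2 (by simpa [bar_involutive a] using hlet a' (bar a) h3 h1)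
      subst hab
      rcases w₀ with _ | ⟨c, w₀⟩
      · simp only [List.nil_append, List.cons.injEq] at hw₀
        simp [bar, Prod.ext_iff] at hw₀
      · simp only [List.cons_append, List.cons.injEq] at hw₀
        obtain ⟨rfl, rfl⟩ := hw₀
        have := hinf (w' := w₀) (g' := []) ⟨[a], [bar a], by simp⟩ (List.infix_refl _) (by simp) (by
          have h3 : val R (a :: (w₀ ++ [bar a])) =
              letter R a * val R w₀ * (letter R a)⁻¹ := by
            rw [← letter_bar, ← val_singleton, ← val_singleton, ← val_append, ← val_append]
            simp
          rw [h3, val_nil] at hval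
          rw [val_nil]
          simpa using hval)
        subst this
        simp [bar] at hw
    · obtain ⟨g₀, b', hg₀⟩ : ∃ g₀ b', b :: g = g₀ ++ [b'] := by
        rcases List.eq_nil_or_concat (b :: g) with h | ⟨g₀, b', h⟩
        · simp at h
        · exact ⟨g₀, b', by simpa using h⟩
      -- common first or last letters could be removed
      have hab : a ≠ b := by
        rintro rfl
        apply hne
        congr 1
        refine hinf ⟨[a], [], by simp⟩ ⟨[a], [], by simp⟩ (by simp) ?_
        rw [← List.singleton_append (l := w), ← List.singleton_append (l := g), val_append,
          val_append] at hval
        exact mul_left_cancel hval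
      have hab' : a' ≠ b' := by
        rintro rfl
        apply hne
        rw [hw₀, hg₀]
        congr 1
        refine hinf ⟨[], [a'], by simp [hw₀]⟩ ⟨[], [a'], by simp [hg₀]⟩ (by simp [hw₀]) ?_
        rw [hw₀, hg₀, val_append, val_append] at hval
        exact mul_right_cancel hval
      have hinv : FreeGroup.IsReduced (FreeGroup.invRev (b :: g)) := by
        have := hg.isReduced
        classical
        rw [FreeGroup.isReduced_iff_reduce_eq] at this ⊢
        rw [FreeGroup.reduce_invRev, this]
      -- the first letters `a ≠ b` and the last letters `a' ≠ b'` meet in the cyclic word `w g⁻¹`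
      constructor
      · refine List.isChain_append.2 ⟨hw, hinv, ?_⟩
        intro x hx y hy
        rw [hw₀] at hx
        rw [hg₀, invRev_append] at hy
        obtain rfl : a' = x := by simpa using hx
        obtain rfl : bar b' = y := by simpa [FreeGroup.invRev, bar] using hy
        exact hlet a' b' hab'
      · intro x hx y hy
        rw [invRev_cons, ← List.append_assoc, List.getLast?_concat] at hx
        obtain rfl : bar b = x := by simpa using hx
        obtain rfl : a = y := by simpa using hy
        intro h
        exact (hlet a b hab h.symm).symm

/-- An edge of the Cayley graph that is not a loop. -/
theorem letter_adj {x : Grp R} (a : S × Bool) (h : x ≠ x * letter R a) :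
    (cay R).Adj x (x * letter R a) := by
  rw [cay, SimpleGraph.mulCayley_adj']
  refine ⟨h, ?_⟩
  obtain ⟨s, _ | _⟩ := a
  · refine ⟨PresentedGroup.of s, ⟨s, rfl⟩, .inr ?_⟩
    have : letter R (s, false) = (letter R (s, true))⁻¹ := letter_bar (s, true)
    rw [this]
    exact (inv_mul_cancel_right x (letter R (s, true))).symm
  · exact ⟨PresentedGroup.of s, ⟨s, rfl⟩, .inl rfl⟩

theorem exists_walk (u : Word S) : ∀ x : Grp R,
    ∃ p : (cay R).Walk x (x * val R u), p.length ≤ u.length := by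
  induction u with
  | nil => intro x; exact ⟨SimpleGraph.Walk.nil.copy rfl (by simp [val_nil]), by simp⟩
  | cons a u ih =>
    intro x
    obtain ⟨p, hp⟩ := ih (x * letter R a)
    have hx : x * letter R a * val R u = x * val R (a :: u) := by
      rw [← val_singleton, mul_assoc, ← val_append]; rfl
    by_cases h : x = x * letter R a
    · exact ⟨p.copy h.symm hx, by simp; omega⟩
    · exact ⟨(SimpleGraph.Walk.cons (letter_adj a h) p).copy rfl hx, by simp; omega⟩

theorem exists_word {x y : Grp R} (p : (cay R).Walk x y) :
    ∃ u : Word S, u.length = p.length ∧ x * val R u = y := by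
  induction p with
  | nil => exact ⟨[], rfl, by simp [val_nil]⟩
  | @cons x y z h p ih =>
    obtain ⟨u, hu, rfl⟩ := ih
    rw [cay, SimpleGraph.mulCayley_adj'] at h
    obtain ⟨-, -, ⟨s, rfl⟩, h⟩ := h
    have hs : PresentedGroup.of s = val R [(s, true)] := rfl
    rcases h with h | h
    · refine ⟨(s, true) :: u, by simp [hu], ?_⟩
      rw [← List.singleton_append, val_append, ← mul_assoc, ← h, hs]
    · refine ⟨(s, false) :: u, by simp [hu], ?_⟩
      have hb : val R [(s, false)] = (val R [(s, true)])⁻¹ := letter_bar (s, true)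
      rw [← List.singleton_append, val_append, ← mul_assoc, h, hs, hb, mul_inv_cancel_right]

/-- A path labelled by a reduced word that contains at most a third of any relator is as long as the
distance of its ends. -/
theorem dist_eq_length (hR : CPrime R (1 / 6)) {w : Word S} (hw : FreeGroup.IsReduced w)
    (hwR : ∀ r ∈ symClosure R, ∀ u : Word S, u <:+: w → u <:+: r →
      (u.length : ℝ) ≤ (r.length : ℝ) / 3) (x : Grp R) :
    (cay R).dist x (x * val R w) = w.length := by
  obtain ⟨p, hp⟩ := exists_walk w x
  refine le_antisymm ((SimpleGraph.dist_le p).trans hp) ?_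
  obtain ⟨q, hq⟩ := p.reachable.exists_walk_length_eq_dist
  obtain ⟨u, hu, hux⟩ := exists_word q
  have hex : ∃ g : Word S, val R g = val R w ∧ IsShortest R g := by
    obtain ⟨g, hg, hmin⟩ := WellFounded.has_min (measure (List.length (α := S × Bool))).wf
      {g : Word S | val R g = val R w} ⟨w, rfl⟩
    exact ⟨g, hg, fun g' h => not_lt.1 (hmin g' (h.trans hg))⟩
  obtain ⟨g, hgw, hg⟩ := hex
  have := eq_of_val_eq hR _ le_rfl hw (fun r hr u h1 h2 => by
    have := hwR r hr u h1 h2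
    have h3 : (3 * u.length : ℝ) ≤ r.length := by linarith
    exact_mod_cast h3) hg hgw.symm
  subst this
  rw [← hq, ← hu]
  exact hg u (mul_left_cancel hux)

end

/-! ### Paths and rays -/

section

variable {S : Type*} {R : Set (Word S)}

theorem IsPathLabelled.eq_mul_val {w : Word S} {γ : Fin (w.length + 1) → Grp R}
    (h : IsPathLabelled R w γ) (i : ℕ) : ∀ (k : ℕ) (hk : i + k < w.length + 1),
    γ ⟨i + k, hk⟩ = γ ⟨i, by omega⟩ * val R ((w.drop i).take k) := by
  intro k
  induction k with
  | zero => intro _; simp [val_nil]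
  | succ k ih =>
    intro hk
    have h1 := h ⟨i + k, by omega⟩
    have h2 := ih (by omega)
    have h3 : (w.drop i).take (k + 1) = (w.drop i).take k ++ [w.get ⟨i + k, by omega⟩] := by
      rw [List.take_succ_eq_append_getElem (by simp; omega)]
      simp
    rw [h3, val_append, ← mul_assoc, ← h2, val_singleton]
    exact h1

theorem IsRayLabelled.eq_mul_val {w : ℕ → S × Bool} {γ : ℕ → Grp R} (h : IsRayLabelled R w γ)
    (i k : ℕ) : γ (i + k) = γ i * val R ((List.range k).map fun t => w (i + t)) := by
  induction k with
  | zero => simp [val_nil]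
  | succ k ih =>
    rw [List.range_succ, List.map_append, val_append, ← mul_assoc, ← ih, List.map_singleton,
      val_singleton]
    exact h (i + k)

theorem IsReducedInf.isReduced {w : ℕ → S × Bool} (h : IsReducedInf w) (i k : ℕ) :
    FreeGroup.IsReduced ((List.range k).map fun t => w (i + t)) := by
  refine List.isChain_iff_getElem.2 fun t ht => ?_
  simp only [List.getElem_map, List.getElem_range]
  exact h (i + t)

theorem isSubwordInf_of_infix {w : ℕ → S × Bool} {i k : ℕ} {u : Word S}
    (h : u <:+: (List.range k).map fun t => w (i + t)) : IsSubwordInf u w := by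
  obtain ⟨p, s, h⟩ := h
  refine ⟨i + p.length, fun t => ?_⟩
  have h1 : (p ++ u ++ s)[p.length + t]? = some (u.get t) := by
    rw [List.append_assoc, List.getElem?_append_right (by omega), Nat.add_sub_cancel_left,
      List.getElem?_append_left t.2]
    simp
  rw [h, List.getElem?_map] at h1
  obtain ⟨a, ha, h1⟩ := Option.map_eq_some_iff.1 h1
  have := List.getElem?_eq_some_iff.1 ha
  obtain ⟨hlt, ha⟩ := this
  rw [List.getElem_range] at ha
  rw [← h1, ← ha, add_assoc]

end

end SmallCancellation

theorem mainTheorem7 {S : Type*} [Finite S] (R : Set (SmallCancellation.Word S))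
    (hR : SmallCancellation.CPrime R (1 / 6)) :
    (∀ (w : SmallCancellation.Word S) (γ : Fin (w.length + 1) → SmallCancellation.Grp R),
      FreeGroup.IsReduced w →
      SmallCancellation.IsPathLabelled R w γ →
      (∀ r ∈ SmallCancellation.symClosure R, ∀ u : SmallCancellation.Word S,
        u <:+: w → u <:+: r → (u.length : ℝ) ≤ (r.length : ℝ) / 3) →
      SmallCancellation.IsGeodesicPath R γ) ∧
    (∀ (w : ℕ → S × Bool) (γ : ℕ → SmallCancellation.Grp R),
      SmallCancellation.IsReducedInf w →
      SmallCancellation.IsRayLabelled R w γ →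
      (∀ r ∈ SmallCancellation.symClosure R, ∀ u : SmallCancellation.Word S,
        SmallCancellation.IsSubwordInf u w → u <:+: r → (u.length : ℝ) ≤ (r.length : ℝ) / 3) →
      SmallCancellation.IsGeodesicRay R γ) := by
  constructor
  · rintro w γ hw hγ hwR ⟨i, hi⟩ ⟨j, hj⟩ hij
    obtain ⟨k, rfl⟩ := Nat.exists_eq_add_of_le (show i ≤ j from hij)
    have hinf : (w.drop i).take k <:+: w :=
      (List.take_prefix _ _).isInfix.trans (List.drop_suffix _ _).isInfix
    rw [hγ.eq_mul_val i k hj, SmallCancellation.dist_eq_length hR (hw.infix hinf)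
      fun r hr u hu => hwR r hr u (hu.trans hinf)]
    simp
    omega
  · intro w γ hw hγ hwR i j hij
    obtain ⟨k, rfl⟩ := Nat.exists_eq_add_of_le hij
    rw [hγ.eq_mul_val i k, SmallCancellation.dist_eq_length hR (hw.isReduced i k)
      fun r hr u hu => hwR r hr u (SmallCancellation.isSubwordInf_of_infix hu)]
    simp
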